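/- Let $V$ be a finite dimensional complex vector space with a symplectic form $\omega$ (a nondegenerate alternating bilinear form), and let $G$ be a finite group acting faithfully and linearly on $V$ and preserving $\omega$. Assume that $(\wedge^2V)^G=\mathbb{C}\omega$, i.e. (identifying $V$ with $V^*$ by $\omega$) every $G$-invariant alternating bilinear form on $V$ is a scalar multiple of $\omega$. Let $S\subset G$ be the set of symplectic reflections, i.e. of those $s\in G$ for which $1-s$ has rank $2$ on $V$. For $s\in S$ let $\omega_s(x,y)$ be $\omega$ applied to the projections of $x,y$ to the image of $1-s$ along the kernel of $1-s$. Let $\kappa:\wedge^2V\to\mathbb{C}[G]$ be a $G$-equivariant linear map, where $G$ acts on $\mathbb{C}[G]$ by conjugation. Let $G\ltimes T(V)$ and $G\ltimes SV$ be the semidirect products of $G$ with the tensor algebra and the symmetric algebra of $V$ (so that $gxg^{-1}=g(x)$ for $g\in G$, $x\in V$), and let $H_\kappa$ be the quotient of $G\ltimes T(V)$ by the two-sided ideal generated by the relations $[x,y]=\kappa(x,y)$, $x,y\in V$. Put on $H_\kappa$ the increasing filtration with $\deg V=1$, $\deg G=0$, whose $n$-th step is spanned by the images of $x_1\cdots x_k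 g$ with $k\le n$, $x_i\in V$, $g\in G$. Let $\xi: G\ltimes SV\to \mathrm{gr}\,H_\kappa$ be the natural surjective algebra homomorphism, sending $x\in V$ to its class in degree $1$ and $g\in G$ to its class in degree $0$. Then $\xi$ is an isomorphism if and only if there are $t\in\mathbb{C}$ and a function $c:S\to\mathbb{C}$, invariant under conjugation by $G$, such that $$\kappa(x,y)=t\,\omega(x,y)-2\sum_{s\in S}c_s\,\omega_s(x,y)\,s\qquad\text{for all }x,y\in V.$$ -/

import Mathlib

open scoped DirectSum

noncomputable section

namespace SymplecticReflection

/-! ### The associated graded algebra of a filtered algebra -/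

section AssociatedGraded

variable {R A : Type*} [CommRing R] [Ring A] [Algebra R A] (F : ℕ → Submodule R A)

/-- The previous step `F (n - 1)` of the filtration, with the convention `F (-1) = 0`. -/
def prevStep : ℕ → Submodule R A
  | 0 => ⊥
  | n + 1 => F n

/-- The `n`-th graded piece `F n / F (n - 1)`. -/
def GrPiece (n : ℕ) : Type _ := F n ⧸ (prevStep F n).submoduleOf (F n)

instance (n : ℕ) : AddCommGroup (GrPiece F n) :=
  inferInstanceAs (AddCommGroup (F n ⧸ (prevStep F n).submoduleOf (F n)))

instance (n : ℕ) : Module R (GrPiece F n) :=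
  inferInstanceAs (Module R (F n ⧸ (prevStep F n).submoduleOf (F n)))

/-- The class in `F n / F (n - 1)` of an element of `F n`. -/
def grMk (n : ℕ) : F n →ₗ[R] GrPiece F n := ((prevStep F n).submoduleOf (F n)).mkQ

theorem grMk_surjective (n : ℕ) : Function.Surjective (grMk F n) :=
  Submodule.mkQ_surjective _

theorem grMk_eq_zero {n : ℕ} {a : F n} (h : (a : A) ∈ prevStep F n) : grMk F n a = 0 :=
  (Submodule.Quotient.mk_eq_zero _).2 h

theorem grMk_sigma_eq {m n : ℕ} (h : m = n) {a : F m} {b : F n} (hab : (a : A) = b) :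
    GradedMonoid.mk (A := GrPiece F) m (grMk F m a) = GradedMonoid.mk n (grMk F n b) := by
  subst h
  rw [Subtype.ext hab]

/-- The associated graded algebra `gr A = ⨁ n, F n / F (n - 1)`. -/
abbrev Gr : Type _ := ⨁ n, GrPiece F n

/-- The class in degree `n` of `gr A` of an element of `F n`. -/
def symbol (n : ℕ) : F n →ₗ[R] Gr F := DirectSum.lof R ℕ (GrPiece F) n ∘ₗ grMk F n

theorem symbol_congr {m n : ℕ} (h : m = n) {a : F m} {b : F n} (hab : (a : A) = b) :
    symbol F m a = symbol F n b := by
  subst h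
  rw [Subtype.ext hab]

theorem symbol_eq_zero {n : ℕ} {a : F n} (h : (a : A) ∈ prevStep F n) : symbol F n a = 0 := by
  simp [symbol, grMk_eq_zero F h]

variable [SetLike.GradedMonoid F]

theorem mul_mem_prevStep_left {i j : ℕ} {a b : A} (ha : a ∈ prevStep F i) (hb : b ∈ F j) :
    a * b ∈ prevStep F (i + j) := by
  cases i with
  | zero =>
    have : a = 0 := ha
    simp [this]
  | succ i =>
    rw [Nat.succ_add]
    exact SetLike.mul_mem_graded (A := F) ha hb

theorem mul_mem_prevStep_right {i j : ℕ} {a b : A} (ha : a ∈ F i) (hb : b ∈ prevStep F j) :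
    a * b ∈ prevStep F (i + j) := by
  cases j with
  | zero =>
    have : b = 0 := hb
    simp [this]
  | succ j => exact SetLike.mul_mem_graded (A := F) ha hb

/-- Multiplication `F i × F j → F (i + j)`. -/
def filtMul (i j : ℕ) : F i →ₗ[R] F j →ₗ[R] F (i + j) :=
  LinearMap.mk₂ R (fun a b => ⟨(a : A) * b, SetLike.mul_mem_graded a.2 b.2⟩)
    (fun _ _ _ => Subtype.ext (by simp [add_mul]))
    (fun _ _ _ => Subtype.ext (by simp))
    (fun _ _ _ => Subtype.ext (by simp [mul_add]))
    (fun _ _ _ => Subtype.ext (by simp))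

/-- The product `gr_i × gr_j → gr_{i+j}` induced by the multiplication of `A`. -/
def grMul (i j : ℕ) : GrPiece F i →ₗ[R] GrPiece F j →ₗ[R] GrPiece F (i + j) :=
  Submodule.liftQ ((prevStep F i).submoduleOf (F i))
    (LinearMap.flip (Submodule.liftQ ((prevStep F j).submoduleOf (F j))
      (LinearMap.flip ((filtMul F i j).compr₂ (grMk F (i + j))))
      (fun b hb => by
        refine LinearMap.mem_ker.2 (LinearMap.ext fun a => ?_)
        exact grMk_eq_zero F (mul_mem_prevStep_right F a.2 hb))))
    (fun a ha => by
      refine LinearMap.mem_ker.2 (LinearMap.ext fun b => ?_)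
      obtain ⟨b, rfl⟩ := grMk_surjective F j b
      exact grMk_eq_zero F (mul_mem_prevStep_left F ha b.2))

theorem grMul_mk {i j : ℕ} (a : F i) (b : F j) :
    grMul F i j (grMk F i a) (grMk F j b) =
      grMk F (i + j) ⟨(a : A) * b, SetLike.mul_mem_graded a.2 b.2⟩ := rfl

instance grGMul : GradedMonoid.GMul (GrPiece F) where
  mul a b := grMul F _ _ a b

instance grGOne : GradedMonoid.GOne (GrPiece F) where
  one := grMk F 0 ⟨1, SetLike.one_mem_graded F⟩

instance grGRing : DirectSum.GRing (GrPiece F) where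
  mul_zero a := map_zero (grMul F _ _ a)
  zero_mul b := by
    change grMul F _ _ 0 b = 0
    simp
  mul_add a b c := map_add (grMul F _ _ a) b c
  add_mul a b c := by
    change grMul F _ _ (a + b) c = grMul F _ _ a c + grMul F _ _ b c
    simp
  one_mul := by
    rintro ⟨i, a⟩
    obtain ⟨a, rfl⟩ := grMk_surjective F i a
    exact grMk_sigma_eq F (zero_add i) (one_mul _)
  mul_one := by
    rintro ⟨i, a⟩
    obtain ⟨a, rfl⟩ := grMk_surjective F i a
    exact grMk_sigma_eq F (add_zero i) (mul_one _)
  mul_assoc := by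
    rintro ⟨i, a⟩ ⟨j, b⟩ ⟨k, c⟩
    obtain ⟨a, rfl⟩ := grMk_surjective F i a
    obtain ⟨b, rfl⟩ := grMk_surjective F j b
    obtain ⟨c, rfl⟩ := grMk_surjective F k c
    exact grMk_sigma_eq F (add_assoc i j k) (mul_assoc _ _ _)
  natCast n := n • grMk F 0 ⟨1, SetLike.one_mem_graded F⟩
  natCast_zero := zero_nsmul _
  natCast_succ n := succ_nsmul _ n
  intCast n := n • grMk F 0 ⟨1, SetLike.one_mem_graded F⟩
  intCast_ofNat n := natCast_zsmul _ n
  intCast_negSucc_ofNat n := negSucc_zsmul _ n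

instance grGAlgebra : DirectSum.GAlgebra R (GrPiece F) where
  toFun := (grMk F 0 ∘ₗ
    LinearMap.toSpanSingleton R (F 0) ⟨1, SetLike.one_mem_graded F⟩).toAddMonoidHom
  map_one := congrArg (grMk F 0) (one_smul R _)
  map_mul r s := by
    exact grMk_sigma_eq F (a := (r * s) • ⟨1, SetLike.one_mem_graded F⟩)
      (b := filtMul F 0 0 (r • ⟨1, SetLike.one_mem_graded F⟩) (s • ⟨1, SetLike.one_mem_graded F⟩))
      (add_zero 0).symm (by simp [filtMul, mul_smul, smul_comm r s])
  commutes := by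
    rintro r ⟨i, a⟩
    obtain ⟨a, rfl⟩ := grMk_surjective F i a
    exact grMk_sigma_eq F (a := filtMul F 0 i (r • ⟨1, SetLike.one_mem_graded F⟩) a)
      (b := filtMul F i 0 a (r • ⟨1, SetLike.one_mem_graded F⟩))
      (add_comm 0 i) (by simp [filtMul])
  smul_def := by
    rintro r ⟨i, a⟩
    obtain ⟨a, rfl⟩ := grMk_surjective F i a
    exact grMk_sigma_eq F (a := r • a)
      (b := filtMul F 0 i (r • ⟨1, SetLike.one_mem_graded F⟩) a)
      (zero_add i).symm (by simp [filtMul])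

theorem symbol_mul {i j : ℕ} (a : F i) (b : F j) :
    symbol F i a * symbol F j b =
      symbol F (i + j) ⟨(a : A) * b, SetLike.mul_mem_graded a.2 b.2⟩ :=
  DirectSum.of_mul_of (A := GrPiece F) _ _

theorem symbol_one : symbol F 0 ⟨1, SetLike.one_mem_graded F⟩ = 1 := rfl

end AssociatedGraded

/-! ### The semidirect products `G ⋉ T(V)` and `G ⋉ S(V)` -/

section Smash

variable (V G : Type*) [AddCommGroup V] [Module ℂ V] [Group G] [DistribMulAction G V]
  [SMulCommClass G ℂ V]

variable {G} in
/-- The linear operator on `V` given by a group element. -/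
abbrev act (g : G) : V →ₗ[ℂ] V := DistribSMul.toLinearMap ℂ V g

/-- The action of `G` on the tensor algebra by algebra automorphisms extending that on `V`. -/
instance tensorAction : MulSemiringAction G (TensorAlgebra ℂ V) where
  smul g := TensorAlgebra.lift ℂ (TensorAlgebra.ι ℂ ∘ₗ act V g)
  one_smul a := by
    change TensorAlgebra.lift ℂ (TensorAlgebra.ι ℂ ∘ₗ act V (1 : G)) a = AlgHom.id ℂ _ a
    congr 1
    ext x
    simp
  mul_smul g h a := by
    change TensorAlgebra.lift ℂ (TensorAlgebra.ι ℂ ∘ₗ act V (g * h)) a =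
      ((TensorAlgebra.lift ℂ (TensorAlgebra.ι ℂ ∘ₗ act V g)).comp
        (TensorAlgebra.lift ℂ (TensorAlgebra.ι ℂ ∘ₗ act V h))) a
    congr 1
    ext x
    simp [mul_smul]
  smul_zero g := map_zero (TensorAlgebra.lift ℂ (TensorAlgebra.ι ℂ ∘ₗ act V g))
  smul_add g := map_add (TensorAlgebra.lift ℂ (TensorAlgebra.ι ℂ ∘ₗ act V g))
  smul_one g := map_one (TensorAlgebra.lift ℂ (TensorAlgebra.ι ℂ ∘ₗ act V g))
  smul_mul g := map_mul (TensorAlgebra.lift ℂ (TensorAlgebra.ι ℂ ∘ₗ act V g))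

instance tensorAction_comm : SMulCommClass G ℂ (TensorAlgebra ℂ V) where
  smul_comm g r := map_smul (TensorAlgebra.lift ℂ (TensorAlgebra.ι ℂ ∘ₗ act V g)) r

/-- The action of `G` on the symmetric algebra by algebra automorphisms extending that on `V`. -/
instance symAction : MulSemiringAction G (SymmetricAlgebra ℂ V) where
  smul g := SymmetricAlgebra.lift (SymmetricAlgebra.ι ℂ V ∘ₗ act V g)
  one_smul a := by
    change SymmetricAlgebra.lift (SymmetricAlgebra.ι ℂ V ∘ₗ act V (1 : G)) a = AlgHom.id ℂ _ a
    congr 1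
    apply SymmetricAlgebra.algHom_ext
    ext x
    simp
  mul_smul g h a := by
    change SymmetricAlgebra.lift (SymmetricAlgebra.ι ℂ V ∘ₗ act V (g * h)) a =
      ((SymmetricAlgebra.lift (SymmetricAlgebra.ι ℂ V ∘ₗ act V g)).comp
        (SymmetricAlgebra.lift (SymmetricAlgebra.ι ℂ V ∘ₗ act V h))) a
    congr 1
    apply SymmetricAlgebra.algHom_ext
    ext x
    simp [mul_smul]
  smul_zero g := map_zero (SymmetricAlgebra.lift (SymmetricAlgebra.ι ℂ V ∘ₗ act V g))
  smul_add g := map_add (SymmetricAlgebra.lift (SymmetricAlgebra.ι ℂ V ∘ₗ act V g))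
  smul_one g := map_one (SymmetricAlgebra.lift (SymmetricAlgebra.ι ℂ V ∘ₗ act V g))
  smul_mul g := map_mul (SymmetricAlgebra.lift (SymmetricAlgebra.ι ℂ V ∘ₗ act V g))

instance symAction_comm : SMulCommClass G ℂ (SymmetricAlgebra ℂ V) where
  smul_comm g r := map_smul (SymmetricAlgebra.lift (SymmetricAlgebra.ι ℂ V ∘ₗ act V g)) r

variable {V G} in
theorem smul_tensor_ι (g : G) (x : V) :
    g • TensorAlgebra.ι ℂ x = TensorAlgebra.ι ℂ (g • x) :=
  TensorAlgebra.lift_ι_apply _ _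

variable {V G} in
theorem smul_sym_ι (g : G) (x : V) :
    g • SymmetricAlgebra.ι ℂ V x = SymmetricAlgebra.ι ℂ V (g • x) :=
  SymmetricAlgebra.lift_ι_apply _ _

/-- `G ⋉ T(V)`: sums of elements `single g a` (that is, `a g`) with
`(a g) (b h) = (a (g • b)) (g h)`. -/
abbrev SmashTensor : Type _ := SkewMonoidAlgebra (TensorAlgebra ℂ V) G

/-- `G ⋉ S(V)`. -/
abbrev SmashSym : Type _ := SkewMonoidAlgebra (SymmetricAlgebra ℂ V) G

variable {V} in
/-- A vector, as an element of `G ⋉ T(V)`. -/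
def vec : V →ₗ[ℂ] SmashTensor V G := (SkewMonoidAlgebra.lsingle ℂ 1) ∘ₗ TensorAlgebra.ι ℂ

/-- The inclusion of the group algebra in `G ⋉ T(V)`. -/
def groupAlg : MonoidAlgebra ℂ G →ₐ[ℂ] SmashTensor V G :=
  MonoidAlgebra.lift ℂ (SmashTensor V G) G (SkewMonoidAlgebra.of (TensorAlgebra ℂ V) G)

end Smash

/-! ### The algebra `H_κ`, its filtration, and the natural map `ξ` -/

section Hkappa

variable {V G : Type*} [AddCommGroup V] [Module ℂ V] [Group G] [DistribMulAction G V]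
  [SMulCommClass G ℂ V] (κ : V →ₗ[ℂ] V →ₗ[ℂ] MonoidAlgebra ℂ G)

/-- The relations `[x, y] = κ(x, y)`. -/
inductive HRel : SmashTensor V G → SmashTensor V G → Prop
  | comm (x y : V) :
    HRel (vec G x * vec G y - vec G y * vec G x) (groupAlg V G (κ x y))

/-- The quotient `H_κ` of `G ⋉ T(V)` by the relations `[x, y] = κ(x, y)`. -/
def H : Type _ := RingQuot (HRel κ)

instance : Ring (H κ) := inferInstanceAs (Ring (RingQuot (HRel κ)))

instance : Algebra ℂ (H κ) := inferInstanceAs (Algebra ℂ (RingQuot (HRel κ)))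

/-- The projection `G ⋉ T(V) → H_κ`. -/
def proj : SmashTensor V G →ₐ[ℂ] H κ := RingQuot.mkAlgHom ℂ (HRel κ)

theorem proj_rel (x y : V) :
    proj κ (vec G x) * proj κ (vec G y) - proj κ (vec G y) * proj κ (vec G x) =
      proj κ (groupAlg V G (κ x y)) := by
  rw [← map_mul (proj κ), ← map_mul (proj κ), ← map_sub (proj κ)]
  exact RingQuot.mkAlgHom_rel ℂ (HRel.comm x y)

/-- The increasing filtration of `H_κ` with `deg V = 1`, `deg G = 0`: the `n`-th step is spanned
by the images of the `x₁ ⋯ x_k g` with `k ≤ n`, `x_i ∈ V`, `g ∈ G`. -/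
def filt (n : ℕ) : Submodule ℂ (H κ) :=
  Submodule.span ℂ {a | ∃ l : List V, l.length ≤ n ∧ ∃ g : G,
    a = (l.map fun x => proj κ (vec G x)).prod *
      proj κ (SkewMonoidAlgebra.of (TensorAlgebra ℂ V) G g)}

theorem filt_mono : Monotone (filt κ) := fun _ _ h =>
  Submodule.span_mono fun _ ⟨l, hl, g, e⟩ => ⟨l, hl.trans h, g, e⟩

theorem of_mul_vec (g : G) (x : V) :
    SkewMonoidAlgebra.of (TensorAlgebra ℂ V) G g * vec G x =
      vec G (g • x) * SkewMonoidAlgebra.of (TensorAlgebra ℂ V) G g := by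
  simp [vec, SkewMonoidAlgebra.lsingle_apply, SkewMonoidAlgebra.single_mul_single, smul_tensor_ι]

theorem of_mul_prod (g : G) (l : List V) :
    proj κ (SkewMonoidAlgebra.of (TensorAlgebra ℂ V) G g) *
        (l.map fun x => proj κ (vec G x)).prod =
      ((l.map (g • ·)).map fun x => proj κ (vec G x)).prod *
        proj κ (SkewMonoidAlgebra.of (TensorAlgebra ℂ V) G g) := by
  induction l with
  | nil => simp
  | cons x l ih =>
    simp only [List.map_cons, List.prod_cons]
    rw [← mul_assoc, ← map_mul, of_mul_vec, map_mul, mul_assoc, ih, mul_assoc]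

instance filt_graded : SetLike.GradedMonoid (filt κ) where
  one_mem := Submodule.subset_span ⟨[], le_rfl, 1, by simp⟩
  mul_mem := by
    intro i j a b ha hb
    have h : filt κ i * filt κ j ≤ filt κ (i + j) := by
      rw [filt, filt, Submodule.span_mul_span]
      refine Submodule.span_le.2 ?_
      rintro _ ⟨_, ⟨l, hl, g, rfl⟩, _, ⟨l', hl', g', rfl⟩, rfl⟩
      refine Submodule.subset_span ⟨l ++ l'.map (g • ·), ?_, g * g', ?_⟩
      · simpa using Nat.add_le_add hl hl'
      · simp only [List.map_append, List.prod_append, map_mul]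
        rw [mul_assoc, ← mul_assoc _ _ (proj κ _), of_mul_prod]
        simp only [mul_assoc]
    exact h (Submodule.mul_mem_mul ha hb)

theorem vec_mem (x : V) : proj κ (vec G x) ∈ filt κ 1 :=
  Submodule.subset_span ⟨[x], le_rfl, 1, by simp⟩

theorem of_mem (g : G) : proj κ (SkewMonoidAlgebra.of (TensorAlgebra ℂ V) G g) ∈ filt κ 0 :=
  Submodule.subset_span ⟨[], le_rfl, g, by simp⟩

theorem groupAlg_mem (a : MonoidAlgebra ℂ G) : proj κ (groupAlg V G a) ∈ filt κ 0 := by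
  induction a using MonoidAlgebra.induction_on with
  | of g => simpa [groupAlg] using of_mem κ g
  | add a b ha hb => simpa using add_mem ha hb
  | smul r a ha => simpa using Submodule.smul_mem _ r ha

/-- The associated graded algebra of `H_κ`. -/
abbrev GrH : Type _ := Gr (filt κ)

/-- The class of `V` in degree one of `gr H_κ`. -/
def grVec : V →ₗ[ℂ] GrH κ :=
  symbol (filt κ) 1 ∘ₗ ((proj κ).toLinearMap ∘ₗ vec G).codRestrict (filt κ 1) (vec_mem κ)

/-- The class of `G` in degree zero of `gr H_κ`. -/
def grGrp : G →* GrH κ where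
  toFun g := symbol (filt κ) 0 ⟨proj κ (SkewMonoidAlgebra.of (TensorAlgebra ℂ V) G g), of_mem κ g⟩
  map_one' := symbol_congr _ rfl (by simp)
  map_mul' g h := by
    rw [symbol_mul]
    refine symbol_congr _ rfl ?_
    change proj κ _ = proj κ _ * proj κ _
    rw [map_mul, map_mul]

theorem grVec_comm (x y : V) : grVec κ x * grVec κ y = grVec κ y * grVec κ x := by
  rw [← sub_eq_zero]
  simp only [grVec, LinearMap.comp_apply, symbol_mul]
  rw [← map_sub]
  refine symbol_eq_zero _ ?_
  change proj κ (vec G x) * proj κ (vec G y) - proj κ (vec G y) * proj κ (vec G x) ∈ filt κ 1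
  rw [proj_rel]
  exact filt_mono κ zero_le_one (groupAlg_mem κ _)

theorem grVec_smul_mul (g : G) (x : V) :
    grVec κ (g • x) * grGrp κ g = grGrp κ g * grVec κ x := by
  change symbol _ _ _ * symbol _ _ _ = symbol _ _ _ * symbol _ _ _
  rw [symbol_mul, symbol_mul]
  refine symbol_congr _ rfl ?_
  change proj κ (vec G (g • x)) * proj κ _ = proj κ _ * proj κ (vec G x)
  rw [← map_mul, ← map_mul, of_mul_vec]

/-- The algebra homomorphism from `S(V)` induced by a linear map with pairwise commuting values. -/
def symLift {B : Type*} [Ring B] [Algebra ℂ B] (f : V →ₗ[ℂ] B)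
    (hf : ∀ x y, f x * f y = f y * f x) : SymmetricAlgebra ℂ V →ₐ[ℂ] B :=
  RingCon.liftₐ (TensorAlgebra.symRingCon ℂ V) (TensorAlgebra.lift ℂ f) (by
    refine RingCon.ringConGen_le.2 ?_
    rintro _ _ ⟨x, y⟩
    rw [RingCon.ker_apply]
    simpa using hf x y)

theorem symLift_ι {B : Type*} [Ring B] [Algebra ℂ B] (f : V →ₗ[ℂ] B)
    (hf : ∀ x y, f x * f y = f y * f x) (x : V) :
    symLift f hf (SymmetricAlgebra.ι ℂ V x) = f x :=
  TensorAlgebra.lift_ι_apply f x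

theorem symLift_smul_mul (g : G) (a : SymmetricAlgebra ℂ V) :
    symLift (grVec κ) (grVec_comm κ) (g • a) * grGrp κ g =
      grGrp κ g * symLift (grVec κ) (grVec_comm κ) a := by
  induction a using SymmetricAlgebra.induction with
  | algebraMap r =>
    rw [smul_algebraMap, AlgHom.commutes, Algebra.commutes]
  | ι x => rw [smul_sym_ι, symLift_ι, symLift_ι, grVec_smul_mul]
  | mul a b ha hb => rw [smul_mul', map_mul, map_mul, mul_assoc, hb, ← mul_assoc, ha, mul_assoc]
  | add a b ha hb => rw [smul_add, map_add, map_add, add_mul, mul_add, ha, hb]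

/-- The natural homomorphism `ξ : G ⋉ S(V) → gr H_κ`, sending `x ∈ V` to its class in degree one
and `g ∈ G` to its class in degree zero. -/
def xi : SmashSym V G →ₐ[ℂ] GrH κ :=
  SkewMonoidAlgebra.liftNCAlgHom (symLift (grVec κ) (grVec_comm κ)) (grGrp κ)
    (fun {a g} => symLift_smul_mul κ g a)

theorem xi_vec (x : V) :
    xi κ (SkewMonoidAlgebra.single 1 (SymmetricAlgebra.ι ℂ V x)) = grVec κ x := by
  change SkewMonoidAlgebra.liftNC _ _ _ = _
  simp [symLift_ι]

theorem xi_grp (g : G) : xi κ (SkewMonoidAlgebra.single g 1) = grGrp κ g := by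
  change SkewMonoidAlgebra.liftNC _ _ _ = _
  simp

theorem xi_list (l : List V) : ∃ a, ∃ h : (l.map fun x => proj κ (vec G x)).prod ∈ filt κ l.length,
    xi κ a = symbol (filt κ) l.length ⟨_, h⟩ := by
  induction l with
  | nil => exact ⟨1, SetLike.one_mem_graded _, (map_one _).trans (symbol_one _).symm⟩
  | cons x l ih =>
    obtain ⟨a, h, e⟩ := ih
    have h2 := SetLike.mul_mem_graded (vec_mem κ x) h
    refine ⟨SkewMonoidAlgebra.single 1 (SymmetricAlgebra.ι ℂ V x) * a, by simpa [add_comm] using h2, ?_⟩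
    rw [map_mul, e, xi_vec]
    exact (symbol_mul (filt κ) ⟨_, vec_mem κ x⟩ ⟨_, h⟩).trans (symbol_congr _ (by simp [add_comm]) (by simp))

theorem xi_surjective : Function.Surjective (xi κ) := by
  rw [← AlgHom.range_eq_top, eq_top_iff]
  rintro z -
  induction z using DirectSum.induction_on with
  | zero => exact zero_mem _
  | add a b ha hb => exact add_mem ha hb
  | of n a =>
    obtain ⟨⟨a, ha⟩, rfl⟩ := grMk_surjective _ _ a
    change symbol (filt κ) n ⟨a, ha⟩ ∈ _
    induction ha using Submodule.span_induction with
    | zero =>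
      have : symbol (filt κ) n ⟨0, zero_mem _⟩ = 0 := map_zero _
      rw [this]; exact zero_mem _
    | add x y hx hy ihx ihy =>
      have := add_mem ihx ihy
      rwa [← map_add] at this
    | smul r x hx ih =>
      have := Subalgebra.smul_mem _ ih r
      rwa [← map_smul] at this
    | mem x hx =>
      obtain ⟨l, hl, g, rfl⟩ := hx
      rcases hl.lt_or_eq with hl | hl
      · rw [symbol_eq_zero]; exact zero_mem _
        cases n with
        | zero => simp at hl
        | succ n => exact Submodule.subset_span ⟨l, Nat.lt_succ_iff.1 hl, g, rfl⟩
      · obtain ⟨a, h, e⟩ := xi_list κ l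
        refine ⟨a * SkewMonoidAlgebra.single g 1, ?_⟩
        change xi κ _ = _
        rw [map_mul, e, xi_grp]
        exact (symbol_mul (filt κ) ⟨_, h⟩ ⟨_, of_mem κ g⟩).trans (symbol_congr _ (by simpa using hl) (by simp))

end Hkappa

/-! ### Symplectic reflections and the forms `ω_s` -/

section Reflections

variable (V : Type*) {G : Type*} [AddCommGroup V] [Module ℂ V] [Group G] [DistribMulAction G V]
  [SMulCommClass G ℂ V]

/-- The operator `1 - g` on `V`. -/
def oneSub (g : G) : V →ₗ[ℂ] V := LinearMap.id - act V g

variable (G) in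
/-- The set of symplectic reflections: the elements `s` such that `1 - s` has rank two on `V`. -/
def reflections : Set G := {s | Module.finrank ℂ (LinearMap.range (oneSub V s)) = 2}

variable [FiniteDimensional ℂ V] [Finite G]

theorem isCompl_oneSub (g : G) :
    IsCompl (LinearMap.range (oneSub V g)) (LinearMap.ker (oneSub V g)) := by
  refine (Submodule.isCompl_iff_disjoint _ _
    (LinearMap.finrank_range_add_finrank_ker _).ge).2 ?_
  rw [Submodule.disjoint_def]
  rintro _ ⟨x, rfl⟩ hy
  set y := oneSub V g x with hyd
  have hgx : g • x = x - y := by simp [hyd, oneSub]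
  have hgy : g • y = y := by
    have : y - g • y = 0 := by simpa [oneSub] using hy
    exact (sub_eq_zero.1 this).symm
  have hpow : ∀ k : ℕ, g ^ k • x = x - (k : ℂ) • y := by
    intro k
    induction k with
    | zero => simp
    | succ k ih =>
      rw [pow_succ', mul_smul, ih, smul_sub, smul_comm g, hgx, hgy]
      push_cast
      rw [add_smul, one_smul]
      abel
  have h := hpow (Nat.card G)
  rw [pow_card_eq_one', one_smul, eq_comm, sub_eq_self] at h
  exact (smul_eq_zero.1 h).resolve_left (Nat.cast_ne_zero.2 Nat.card_pos.ne')

variable {V}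

/-- The form `ω_s`: `ω` applied to the projections to the image of `1 - s` along its kernel. -/
def omegaS (ω : LinearMap.BilinForm ℂ V) (s : G) : LinearMap.BilinForm ℂ V :=
  ω.compl₁₂
    ((LinearMap.range (oneSub V s)).projection (LinearMap.ker (oneSub V s)) (isCompl_oneSub V s))
    ((LinearMap.range (oneSub V s)).projection (LinearMap.ker (oneSub V s)) (isCompl_oneSub V s))

end Reflections

end SymplecticReflection

end

/-!
The map `ξ` is always surjective. It is injective exactly when `κ` is alternating, equivariant and
satisfies the Jacobi identity `[κ(x, y), z] + [κ(y, z), x] + [κ(z, x), y] = 0` in `G ⋉ T(V)`.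
These conditions are necessary: alternation, equivariance and the Jacobi identity express that
certain elements of degree at most `1` of `G ⋉ T(V)`, which vanish in `H_κ`, are already zero.

Conversely, the degree-`n` component `G ⋉ T(V) → G ⋉ S(V)` kills the relations of degree at most
`n`, and it suffices to extend it, one degree at a time, to a linear map on `G ⋉ T(V)` killing all
relations. On words in a totally ordered basis such an extension prescribes the change of a value
under each swap of adjacent letters. A prescription of this kind comes from a function on words as
soon as it is consistent on distant swaps and on the braid relation, because sorting a word is
confluent; the braid relation is the Jacobi identity.

The Jacobi identity then decouples over `g ∈ G`: the coefficient `B` of `g` in `κ` satisfies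
`B(x, y) (1 - g) z + B(y, z) (1 - g) x + B(z, x) (1 - g) y = 0`. When `g ≠ 1` this forces
`B = 0`, or `1 - g` to have rank `2` and `B` to be a multiple of `ω_g`.
-/

noncomputable section

namespace SymplecticReflection

section SwapCocycle

variable {ι M : Type*} [LinearOrder ι] [AddCommGroup M]

/-- The number of inversions of a word. -/
def invCount : List ι → ℕ
  | [] => 0
  | a :: l => l.countP (· < a) + invCount l

theorem invCount_swap_lt (u v : List ι) {i j : ι} (h : j < i) :
    invCount (u ++ j :: i :: v) < invCount (u ++ i :: j :: v) := by
  induction u with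
  | nil =>
    simp only [List.nil_append, invCount, List.countP_cons, h, h.not_gt, decide_true, decide_false]
    grind
  | cons a u ih =>
    have hperm : (u ++ j :: i :: v).Perm (u ++ i :: j :: v) := (List.Perm.swap i j v).append_left u
    simp only [List.cons_append, invCount, hperm.countP_eq]
    lia

/-- A descent of the word `w`: two adjacent letters `fst > snd`, recorded together with the
subwords before and after them. -/
structure Descent (w : List ι) where
  before : List ι
  fst : ι
  snd : ι
  after : List ι
  eq : w = before ++ fst :: snd :: after
  lt : snd < fst

/-- The word obtained by exchanging the two letters of a descent. -/
def Descent.swap {w : List ι} (d : Descent w) : List ι := d.before ++ d.snd :: d.fst :: d.after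

/-- The value of a function of swaps at the swap that removes a descent. -/
def Descent.cost {w : List ι} (d : Descent w) (f : List ι → ι → ι → List ι → M) : M :=
  f d.before d.fst d.snd d.after

theorem Descent.invCount_swap_lt {w : List ι} (d : Descent w) : invCount d.swap < invCount w := by
  conv_rhs => rw [d.eq]
  exact SymplecticReflection.invCount_swap_lt _ _ d.lt

/-- `f u i j v` is regarded as the increment of a function of words along the swap of the words
`u i j v` and `u j i v`. It is a cocycle on the words of length `n` if it respects the relations of
the symmetric group `𝔖ₙ`. -/
structure IsSwapCocycle (n : ℕ) (f : List ι → ι → ι → List ι → M) : Prop where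
  self : ∀ u i v, u.length + v.length + 2 = n → f u i i v = 0
  anti : ∀ u i j v, u.length + v.length + 2 = n → f u i j v = -f u j i v
  far : ∀ u i j v k l w, u.length + v.length + w.length + 4 = n →
    f u i j (v ++ k :: l :: w) + f (u ++ j :: i :: v) k l w =
      f (u ++ i :: j :: v) k l w + f u i j (v ++ l :: k :: w)
  braid : ∀ u i j k v, u.length + v.length + 3 = n →
    f u i j (k :: v) + f (u ++ [j]) i k v + f u j k (i :: v) =
      f (u ++ [i]) j k v + f u i k (j :: v) + f (u ++ [k]) i j v

/-- The function `ψ` of words has the increments `f` along the swaps that remove a descent from a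
word of length `n` with less than `m` inversions. -/
def IsPotentialBelow (n : ℕ) (f : List ι → ι → ι → List ι → M) (ψ : List ι → M) (m : ℕ) : Prop :=
  ∀ u i j v, u.length + v.length + 2 = n → j < i → invCount (u ++ i :: j :: v) < m →
    ψ (u ++ i :: j :: v) = ψ (u ++ j :: i :: v) + f u i j v

section Confluence

variable {n : ℕ} {f : List ι → ι → ι → List ι → M} {ψ : List ι → M}

theorem IsSwapCocycle.confluent_of_overlap (hf : IsSwapCocycle n f) {u v : List ι} {i j k : ι}
    (hψ : IsPotentialBelow n f ψ (invCount (u ++ i :: j :: k :: v)))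
    (hlen : u.length + v.length + 3 = n) (hji : j < i) (hkj : k < j) :
    ψ (u ++ j :: i :: k :: v) + f u i j (k :: v) =
      ψ (u ++ i :: k :: j :: v) + f (u ++ [i]) j k v := by
  have hki := hkj.trans hji
  have lt_ij := invCount_swap_lt u (k :: v) hji
  have lt_ik := invCount_swap_lt (u ++ [j]) v hki
  have lt_jk := invCount_swap_lt (u ++ [i]) v hkj
  have lt_ik' := invCount_swap_lt u (j :: v) hki
  have step_ik := hψ (u ++ [j]) i k v
  have step_jk := hψ u j k (i :: v)
  have step_ik' := hψ u i k (j :: v)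
  have step_ij := hψ (u ++ [k]) i j v
  simp only [List.append_assoc, List.cons_append, List.nil_append, List.length_append,
    List.length_cons, List.length_nil] at lt_ik lt_jk step_ik step_jk step_ik' step_ij
  rw [step_ik (by lia) hki lt_ij, step_jk (by lia) hkj (lt_ik.trans lt_ij),
    step_ik' (by lia) hki lt_jk, step_ij (by lia) hji (lt_ik'.trans lt_jk)]
  have braid := hf.braid u i j k v hlen
  grind

theorem IsSwapCocycle.confluent_of_disjoint (hf : IsSwapCocycle n f) {u v w : List ι}
    {i j k l : ι} (hψ : IsPotentialBelow n f ψ (invCount (u ++ i :: j :: (v ++ k :: l :: w))))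
    (hlen : u.length + v.length + w.length + 4 = n) (hji : j < i) (hlk : l < k) :
    ψ (u ++ j :: i :: (v ++ k :: l :: w)) + f u i j (v ++ k :: l :: w) =
      ψ (u ++ i :: j :: (v ++ l :: k :: w)) + f (u ++ i :: j :: v) k l w := by
  have lt_ij := invCount_swap_lt u (v ++ k :: l :: w) hji
  have lt_kl := invCount_swap_lt (u ++ i :: j :: v) w hlk
  have step_kl := hψ (u ++ j :: i :: v) k l w
  have step_ij := hψ u i j (v ++ l :: k :: w)
  simp only [List.append_assoc, List.cons_append, List.length_append, List.length_cons]
    at lt_kl step_kl step_ij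
  rw [step_kl (by lia) hlk lt_ij, step_ij (by lia) hji lt_kl]
  have far := hf.far u i j v k l w hlen
  grind

theorem IsSwapCocycle.confluent (hf : IsSwapCocycle n f) {w : List ι} (hw : w.length = n)
    (hψ : IsPotentialBelow n f ψ (invCount w)) (d e : Descent w)
    (hle : d.before.length ≤ e.before.length) :
    ψ d.swap + d.cost f = ψ e.swap + e.cost f := by
  obtain ⟨u, i, j, v, rfl, hji⟩ := d
  obtain ⟨u', k, l, v', heq, hlk⟩ := e
  simp only [Descent.swap, Descent.cost] at hle ⊢
  simp only [List.length_append, List.length_cons] at hw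
  obtain ⟨t, rfl, ht⟩ : ∃ t, u' = u ++ t ∧ i :: j :: v = t ++ k :: l :: v' := by
    obtain ⟨t, rfl⟩ := List.prefix_of_prefix_length_le ⟨_, rfl⟩ ⟨_, heq.symm⟩ hle
    exact ⟨t, rfl, by simpa using heq⟩
  match t, ht with
  | [], ht =>
    obtain ⟨rfl, rfl, rfl⟩ : i = k ∧ j = l ∧ v = v' := by simpa using ht
    simp
  | [a], ht =>
    obtain ⟨rfl, rfl, rfl⟩ : i = a ∧ j = k ∧ v = l :: v' := by simpa using ht
    simpa using hf.confluent_of_overlap hψ (by simp at hw; lia) hji hlk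
  | a :: b :: t, ht =>
    obtain ⟨rfl, rfl, rfl⟩ : i = a ∧ j = b ∧ v = t ++ k :: l :: v' := by simpa using ht
    simpa using hf.confluent_of_disjoint hψ (by simp at hw; lia) hji hlk

end Confluence

open Classical in
/-- The sum of the values of `f` along a chosen sequence of swaps that sorts a word. -/
def potential (f : List ι → ι → ι → List ι → M) (w : List ι) : M :=
  if h : Nonempty (Descent w) then potential f h.some.swap + h.some.cost f else 0
termination_by invCount w
decreasing_by exact h.some.invCount_swap_lt

variable {n : ℕ} {f : List ι → ι → ι → List ι → M}

theorem IsSwapCocycle.potential_eq (hf : IsSwapCocycle n f) {w : List ι} (hw : w.length = n)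
    (d : Descent w) : potential f w = potential f d.swap + d.cost f := by
  induction hm : invCount w using Nat.strong_induction_on generalizing w with
  | _ m ih =>
    have hψ : IsPotentialBelow n f (potential f) (invCount w) := fun u i j v hlen hji hlt =>
      ih _ (hm ▸ hlt) (by simp only [List.length_append, List.length_cons]; lia)
        ⟨u, i, j, v, rfl, hji⟩ rfl
    have hd : Nonempty (Descent w) := ⟨d⟩
    rw [potential, dif_pos hd]
    rcases le_total hd.some.before.length d.before.length with hle | hle
    · exact hf.confluent hw hψ _ _ hle
    · exact (hf.confluent hw hψ _ _ hle).symm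

theorem IsSwapCocycle.exists_potential (hf : IsSwapCocycle n f) :
    ∃ ψ : List ι → M, ∀ u i j v, u.length + v.length + 2 = n →
      ψ (u ++ i :: j :: v) = ψ (u ++ j :: i :: v) + f u i j v := by
  refine ⟨potential f, fun u i j v hlen => ?_⟩
  have length_eq (a b : ι) : (u ++ a :: b :: v).length = n := by
    simp only [List.length_append, List.length_cons]; lia
  rcases lt_trichotomy i j with hij | rfl | hji
  · have swap := hf.potential_eq (length_eq j i) ⟨u, j, i, v, rfl, hij⟩
    simp only [Descent.swap, Descent.cost] at swap
    rw [swap, hf.anti u i j v hlen, add_neg_cancel_right]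
  · rw [hf.self u i v hlen, add_zero]
  · exact hf.potential_eq (length_eq i j) ⟨u, i, j, v, rfl, hji⟩

end SwapCocycle

section Grading

variable {V G : Type*} [AddCommGroup V] [Module ℂ V] [Group G] [DistribMulAction G V]
  [SMulCommClass G ℂ V]

variable (G) in
/-- The product of a list of vectors in `G ⋉ T(V)`. -/
def word (l : List V) : SmashTensor V G := (l.map (vec G)).prod

variable (V) in
/-- A group element, as an element of `G ⋉ T(V)`. -/
abbrev grp : G →* SmashTensor V G := SkewMonoidAlgebra.of (TensorAlgebra ℂ V) G

@[simp] theorem word_nil : word G ([] : List V) = 1 := rfl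

@[simp] theorem word_cons (x : V) (l : List V) : word G (x :: l) = vec G x * word G l := by
  simp only [word, List.map_cons, List.prod_cons]

@[simp] theorem word_append (l l' : List V) : word G (l ++ l') = word G l * word G l' := by
  simp only [word, List.map_append, List.prod_append]

theorem grp_mul_word (g : G) (l : List V) :
    grp V g * word G l = word G (l.map (g • ·)) * grp V g := by
  induction l with
  | nil => simp
  | cons x l ih =>
    rw [word_cons, ← mul_assoc, of_mul_vec, mul_assoc, ih, List.map_cons, word_cons, mul_assoc]

theorem groupAlg_of (g : G) : groupAlg V G (MonoidAlgebra.of ℂ G g) = grp V g := by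
  simp [groupAlg]

variable (V G) in
/-- The component of degree `k` of `G ⋉ T(V)` for the grading with `deg V = 1` and `deg G = 0`. -/
def grade (k : ℕ) : Submodule ℂ (SmashTensor V G) :=
  Submodule.span ℂ {a | ∃ l : List V, l.length = k ∧ ∃ g : G, a = word G l * grp V g}

theorem word_mul_grp_mem_grade (l : List V) (g : G) : word G l * grp V g ∈ grade V G l.length :=
  Submodule.subset_span ⟨l, rfl, g, rfl⟩

theorem grp_mem_grade_zero (g : G) : grp V g ∈ grade V G 0 := by
  simpa using word_mul_grp_mem_grade ([] : List V) g

theorem vec_mem_grade_one (x : V) : vec G x ∈ grade V G 1 := by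
  simpa using word_mul_grp_mem_grade [x] (1 : G)

theorem groupAlg_mem_grade_zero (a : MonoidAlgebra ℂ G) : groupAlg V G a ∈ grade V G 0 := by
  induction a using MonoidAlgebra.induction_on with
  | of g => simpa only [groupAlg_of] using grp_mem_grade_zero g
  | add a b ha hb => simpa only [map_add] using add_mem ha hb
  | smul r a ha => simpa only [map_smul] using Submodule.smul_mem _ r ha

instance gradedMonoid_grade : SetLike.GradedMonoid (grade V G) where
  one_mem := by simpa only [map_one] using grp_mem_grade_zero (V := V) (1 : G)
  mul_mem i j a c ha hc := by
    suffices grade V G i * grade V G j ≤ grade V G (i + j) from this (Submodule.mul_mem_mul ha hc)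
    rw [grade, grade, Submodule.span_mul_span, Submodule.span_le]
    rintro _ ⟨_, ⟨l, rfl, g, rfl⟩, _, ⟨l', rfl, g', rfl⟩, rfl⟩
    refine Submodule.subset_span ⟨l ++ l'.map (g • ·), by simp, g * g', ?_⟩
    simp only [word_append, map_mul, mul_assoc, ← mul_assoc (grp V g), grp_mul_word]

section Basis

variable {ι : Type*} (b : Module.Basis ι ℂ V)

theorem tensorAlgebra_basis_apply (w : List ι) :
    b.tensorAlgebra (FreeMonoid.ofList w) = (w.map fun i => TensorAlgebra.ι ℂ (b i)).prod := by
  simp [Module.Basis.tensorAlgebra, FreeAlgebra.basisFreeMonoid,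
    FreeAlgebra.equivMonoidAlgebraFreeMonoid, FreeMonoid.lift_ofList, map_list_prod,
    Function.comp_def]

variable (G) in
theorem word_map_eq_single (w : List ι) :
    word G (w.map b) = SkewMonoidAlgebra.single 1 (b.tensorAlgebra (FreeMonoid.ofList w)) := by
  rw [tensorAlgebra_basis_apply]
  induction w with
  | nil => rfl
  | cons i w ih =>
    simp [ih, vec, SkewMonoidAlgebra.lsingle_apply, SkewMonoidAlgebra.single_mul_single]

variable (G) in
/-- The basis of `G ⋉ T(V)` that consists of the products of words in a basis of `V` and elements
of `G`. -/
def wordBasis : Module.Basis (List ι × G) ℂ (SmashTensor V G) :=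
  ((Finsupp.basis fun _ : G => b.tensorAlgebra).map
      (SkewMonoidAlgebra.coeffLinearEquiv (S := ℂ)).symm).reindex
    ((Equiv.sigmaEquivProd G (FreeMonoid ι)).trans
      ((Equiv.prodComm _ _).trans (FreeMonoid.toList.prodCongr (Equiv.refl G))))

theorem wordBasis_apply (w : List ι) (g : G) :
    wordBasis G b (w, g) = word G (w.map b) * grp V g := by
  have single_apply : wordBasis G b (w, g) =
      SkewMonoidAlgebra.single g (b.tensorAlgebra (FreeMonoid.ofList w)) := by
    rw [wordBasis, Module.Basis.reindex_apply, Module.Basis.map_apply, Finsupp.coe_basis]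
    rfl
  simp [single_apply, word_map_eq_single, SkewMonoidAlgebra.single_mul_single]

variable (G) in
theorem span_word_eq_span_word_basis (k : ℕ) :
    Submodule.span ℂ {a | ∃ l : List V, l.length = k ∧ a = word G l} =
      Submodule.span ℂ {a | ∃ w : List ι, w.length = k ∧ a = word G (w.map b)} := by
  refine le_antisymm (Submodule.span_le.2 ?_) (Submodule.span_mono ?_)
  · rintro _ ⟨l, rfl, rfl⟩
    induction l with
    | nil => exact Submodule.subset_span ⟨[], rfl, rfl⟩
    | cons x l ih =>
      have vec_mem_span : vec G x ∈ Submodule.span ℂ (Set.range fun i => vec G (b i)) := by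
        have := Submodule.mem_map_of_mem (f := vec G) (b.mem_span x)
        rwa [Submodule.map_span, ← Set.range_comp] at this
      have mul_mem := Submodule.mul_mem_mul vec_mem_span ih
      rw [Submodule.span_mul_span] at mul_mem
      rw [word_cons]
      refine Submodule.span_mono ?_ mul_mem
      rintro _ ⟨_, ⟨i, rfl⟩, _, ⟨w, hw, rfl⟩, rfl⟩
      exact ⟨i :: w, by simpa using hw, by simp⟩
  · rintro _ ⟨w, rfl, rfl⟩
    exact ⟨w.map b, List.length_map _, rfl⟩

theorem grade_eq_span_word_mul (k : ℕ) :
    grade V G k = Submodule.span ℂ {a | ∃ w : List ι, w.length = k ∧ a = word G (w.map b)} *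
      Submodule.span ℂ (Set.range (grp V)) := by
  rw [← span_word_eq_span_word_basis, Submodule.span_mul_span, grade]
  congr 1
  ext a
  simp only [Set.mem_mul, Set.mem_ofPred_eq, Set.mem_range]
  grind

theorem grade_eq_span_wordBasis (k : ℕ) :
    grade V G k = Submodule.span ℂ (wordBasis G b '' {p | p.1.length = k}) := by
  rw [grade_eq_span_word_mul b, Submodule.span_mul_span]
  congr 1
  ext a
  simp only [Set.mem_mul, Set.mem_ofPred_eq, Set.mem_range, Set.mem_image, Prod.exists,
    wordBasis_apply]
  grind

theorem exists_linearMap_eqOn_grade {M : Type*} [AddCommGroup M] [Module ℂ M]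
    (Φ : ℕ → SmashTensor V G →ₗ[ℂ] M) :
    ∃ Ψ : SmashTensor V G →ₗ[ℂ] M, ∀ k, ∀ a ∈ grade V G k, Ψ a = Φ k a := by
  have b := Module.Basis.ofVectorSpace ℂ V
  refine ⟨(wordBasis G b).constr ℂ fun p => Φ p.1.length (wordBasis G b p), fun k => ?_⟩
  change grade V G k ≤ LinearMap.eqLocus _ _
  rw [grade_eq_span_wordBasis b, Submodule.span_le]
  rintro _ ⟨p, rfl, rfl⟩
  exact (wordBasis G b).constr_basis ℂ _ p

end Basis

variable (V G) in
theorem iSup_grade : ⨆ k, grade V G k = ⊤ := by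
  have b := Module.Basis.ofVectorSpace ℂ V
  rw [eq_top_iff, ← (wordBasis G b).span_eq, Submodule.span_le]
  rintro _ ⟨⟨w, g⟩, rfl⟩
  rw [wordBasis_apply]
  exact Submodule.mem_iSup_of_mem _ (word_mul_grp_mem_grade _ g)

variable (V G) in
/-- The sum of the components of degree less than `n` of `G ⋉ T(V)`. -/
def degLT (n : ℕ) : Submodule ℂ (SmashTensor V G) := ⨆ k, ⨆ _ : k < n, grade V G k

theorem grade_le_degLT {k n : ℕ} (h : k < n) : grade V G k ≤ degLT V G n :=
  le_iSup₂_of_le k h le_rfl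

theorem degLT_mono : Monotone (degLT V G) := fun _ _ hmn =>
  iSup₂_le fun _ hk => grade_le_degLT (hk.trans_le hmn)

end Grading

section Relations

variable {V G : Type*} [AddCommGroup V] [Module ℂ V] [Group G] [DistribMulAction G V]
  [SMulCommClass G ℂ V] (κ : V →ₗ[ℂ] V →ₗ[ℂ] MonoidAlgebra ℂ G)

theorem map_proj_degLT (n : ℕ) :
    (degLT V G n).map (proj κ).toLinearMap = prevStep (filt κ) n := by
  have proj_word_mul_grp (l : List V) (g : G) : proj κ (word G l * grp V g) =
      (l.map fun x => proj κ (vec G x)).prod * proj κ (grp V g) := by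
    rw [map_mul, word, map_list_prod, List.map_map]
    rfl
  cases n with
  | zero => simp [degLT, prevStep]
  | succ n =>
    simp only [degLT, Submodule.map_iSup, prevStep]
    refine le_antisymm (iSup₂_le fun k hk => ?_) (Submodule.span_le.2 ?_)
    · rw [grade, Submodule.map_span_le]
      rintro _ ⟨l, rfl, g, rfl⟩
      exact Submodule.subset_span ⟨l, Nat.lt_succ_iff.1 hk, g, proj_word_mul_grp l g⟩
    · rintro _ ⟨l, hl, g, rfl⟩
      exact Submodule.mem_iSup_of_mem l.length (Submodule.mem_iSup_of_mem (Nat.lt_succ_of_le hl)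
        ⟨_, word_mul_grp_mem_grade l g, proj_word_mul_grp l g⟩)

theorem proj_mem_filt {n : ℕ} {a : SmashTensor V G} (ha : a ∈ grade V G n) :
    proj κ a ∈ filt κ n :=
  (map_proj_degLT κ (n + 1)).le ⟨a, grade_le_degLT n.lt_succ_self ha, rfl⟩

/-- The relator `[x, y] - κ(x, y)` of `H_κ`. -/
def relator : V →ₗ[ℂ] V →ₗ[ℂ] SmashTensor V G :=
  LinearMap.mk₂ ℂ (fun x y => vec G x * vec G y - vec G y * vec G x - groupAlg V G (κ x y))
    (fun x x' y => by simp only [map_add, add_mul, mul_add, LinearMap.add_apply]; abel)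
    (fun r x y => by
      simp only [map_smul, smul_mul_assoc, mul_smul_comm, smul_sub, LinearMap.smul_apply])
    (fun x y y' => by simp only [map_add, add_mul, mul_add]; abel)
    (fun r x y => by simp only [map_smul, smul_mul_assoc, mul_smul_comm, smul_sub])

theorem relator_apply (x y : V) :
    relator κ x y = vec G x * vec G y - vec G y * vec G x - groupAlg V G (κ x y) := rfl

/-- The span of the relators of `H_κ`. -/
def relatorSpan : Submodule ℂ (SmashTensor V G) := Submodule.map₂ (relator κ) ⊤ ⊤

/-- The span of the consequences `a ([x, y] - κ(x, y)) c` of the relations of `H_κ` with `a` and `c`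
homogeneous and of total degree `deg a + 2 + deg c < n`. -/
def relations (n : ℕ) : Submodule ℂ (SmashTensor V G) :=
  ⨆ p : ℕ × ℕ, ⨆ _ : p.1 + p.2 + 2 < n, grade V G p.1 * relatorSpan κ * grade V G p.2

theorem relations_mono : Monotone (relations κ) := fun _ _ hmn =>
  iSup_mono fun _ => iSup_mono' fun hp => ⟨hp.trans_le hmn, le_rfl⟩

theorem mem_top_mul_relatorSpan_mul_top {a : SmashTensor V G} (ha : proj κ a = 0) :
    a ∈ ⊤ * relatorSpan κ * ⊤ := by
  set I := TwoSidedIdeal.span {r | ∃ x y : V, r = relator κ x y}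
  have mk_eq_of_rel ⦃a c : SmashTensor V G⦄ :
      HRel κ a c → I.ringCon.mk' a = I.ringCon.mk' c := by
    rintro ⟨x, y⟩
    exact (RingCon.eq _).2 ((TwoSidedIdeal.rel_iff _ _ _).2 (TwoSidedIdeal.subset_span ⟨x, y, rfl⟩))
  have mem_ideal : a ∈ I := by
    rw [TwoSidedIdeal.mem_iff, ← RingCon.eq]
    change I.ringCon.mk' a = I.ringCon.mk' 0
    rw [← RingQuot.lift_mkRingHom_apply _ mk_eq_of_rel, ← RingQuot.mkAlgHom_coe ℂ]
    exact (congrArg _ ha).trans ((map_zero _).trans (map_zero _).symm)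
  refine (AddSubgroup.closure_le (K := (⊤ * relatorSpan κ * ⊤).toAddSubgroup)).2 ?_
    (TwoSidedIdeal.mem_span_iff_mem_addSubgroup_closure.1 mem_ideal)
  rintro _ ⟨_, ⟨p, -, _, ⟨x, y, rfl⟩, rfl⟩, q, -, rfl⟩
  exact Submodule.mul_mem_mul (Submodule.mul_mem_mul trivial
    (Submodule.apply_mem_map₂ _ trivial trivial)) trivial

theorem exists_mem_relations {a : SmashTensor V G} (ha : proj κ a = 0) :
    ∃ n, a ∈ relations κ n := by
  rw [← Submodule.mem_iSup_of_directed _ (relations_mono κ).directed_le]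
  have top_mul_mul_top_le : ⊤ * relatorSpan κ * ⊤ ≤ ⨆ n, relations κ n := by
    rw [← iSup_grade, Submodule.iSup_mul, Submodule.iSup_mul]
    refine iSup_le fun i => ?_
    rw [Submodule.mul_iSup]
    exact iSup_le fun j =>
      le_iSup_of_le (i + j + 3) (le_iSup₂_of_le (i, j) (Nat.lt_succ_self _) le_rfl)
  exact top_mul_mul_top_le (mem_top_mul_relatorSpan_mul_top κ ha)

/-- Equivariance of `κ` for the conjugation action of `G` on its group algebra. -/
def IsEquivariant : Prop := ∀ (g : G) (x y : V),
  κ (g • x) (g • y) = MonoidAlgebra.of ℂ G g * κ x y * MonoidAlgebra.of ℂ G g⁻¹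

variable {κ}

theorem IsEquivariant.grp_mul_relator (hκ : IsEquivariant κ) (g : G) (x y : V) :
    grp V g * relator κ x y = relator κ (g • x) (g • y) * grp V g := by
  have grp_mul_groupAlg :
      grp V g * groupAlg V G (κ x y) = groupAlg V G (κ (g • x) (g • y)) * grp V g := by
    rw [hκ g x y, map_mul, map_mul, groupAlg_of, groupAlg_of, mul_assoc, mul_assoc, ← map_mul,
      inv_mul_cancel, map_one, mul_one]
  have grp_mul_vec_mul (x : V) (c : SmashTensor V G) :
      grp V g * (vec G x * c) = vec G (g • x) * (grp V g * c) := by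
    rw [← mul_assoc, of_mul_vec, mul_assoc]
  simp only [relator_apply, mul_sub, sub_mul, grp_mul_groupAlg, mul_assoc, grp_mul_vec_mul,
    of_mul_vec]

theorem IsEquivariant.span_grp_mul_relatorSpan_le (hκ : IsEquivariant κ) :
    Submodule.span ℂ (Set.range (grp V)) * relatorSpan κ ≤
      relatorSpan κ * Submodule.span ℂ (Set.range (grp V)) := by
  rw [relatorSpan, ← Submodule.span_univ, Submodule.map₂_span_span, Submodule.span_mul_span,
    Submodule.span_mul_span, Submodule.span_le]
  rintro _ ⟨_, ⟨g, rfl⟩, _, ⟨x, -, y, -, rfl⟩, rfl⟩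
  exact Submodule.subset_span ⟨_, ⟨g • x, trivial, g • y, trivial, rfl⟩, _, ⟨g, rfl⟩,
    (hκ.grp_mul_relator g x y).symm⟩

variable (V G) in
theorem span_grp_mul_grade_le (n : ℕ) :
    Submodule.span ℂ (Set.range (grp V)) * grade V G n ≤ grade V G n := by
  refine (mul_le_mul' (Submodule.span_le.2 ?_) le_rfl).trans
    (Submodule.mul_le.2 fun a ha c hc => zero_add n ▸ SetLike.mul_mem_graded ha hc)
  rintro _ ⟨g, rfl⟩
  exact grp_mem_grade_zero g

theorem IsEquivariant.grade_mul_relatorSpan_mul_grade_le (hκ : IsEquivariant κ) {ι : Type*}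
    (b : Module.Basis ι ℂ V) (i j : ℕ) :
    grade V G i * relatorSpan κ * grade V G j ≤
      Submodule.span ℂ {a | ∃ u v : List ι, u.length = i ∧ v.length = j ∧ ∃ k l, ∃ g : G,
        a = word G (u.map b) * relator κ (b k) (b l) * (word G (v.map b) * grp V g)} := by
  set W := Submodule.span ℂ {a | ∃ w : List ι, w.length = i ∧ a = word G (w.map b)} with hW
  set C := Submodule.span ℂ (Set.range (grp V : G →* SmashTensor V G))
  calc grade V G i * relatorSpan κ * grade V G j
      = W * (C * relatorSpan κ) * grade V G j := by rw [grade_eq_span_word_mul b i, mul_assoc W]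
    _ ≤ W * (relatorSpan κ * C) * grade V G j :=
      mul_le_mul' (mul_le_mul' le_rfl hκ.span_grp_mul_relatorSpan_le) le_rfl
    _ = W * relatorSpan κ * (C * grade V G j) := by simp only [mul_assoc]
    _ ≤ W * relatorSpan κ * grade V G j :=
      mul_le_mul' le_rfl (span_grp_mul_grade_le V G j)
    _ ≤ _ := by
      rw [hW, relatorSpan, ← b.span_eq, Submodule.map₂_span_span, grade_eq_span_word_mul b j,
        Submodule.span_mul_span, Submodule.span_mul_span, Submodule.span_mul_span]
      refine Submodule.span_mono ?_
      rintro _ ⟨_, ⟨_, ⟨u, hu, rfl⟩, _, ⟨_, ⟨k, rfl⟩, _, ⟨l, rfl⟩, rfl⟩, rfl⟩,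
        _, ⟨_, ⟨v, hv, rfl⟩, _, ⟨g, rfl⟩, rfl⟩, rfl⟩
      exact ⟨u, v, hu, hv, k, l, g, rfl⟩

end Relations

section Extension

variable {V G : Type*} [AddCommGroup V] [Module ℂ V] [Group G] [DistribMulAction G V]
  [SMulCommClass G ℂ V] (κ : V →ₗ[ℂ] V →ₗ[ℂ] MonoidAlgebra ℂ G)

/-- The Jacobi identity for `κ`: the identity that the Jacobi identity for the commutators of three
vectors in `H_κ` becomes when `[x, y]` is replaced by `κ(x, y)`. -/
def SatisfiesJacobi : Prop := ∀ x y z : V,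
  ⁅groupAlg V G (κ x y), vec G z⁆ + ⁅groupAlg V G (κ y z), vec G x⁆ +
    ⁅groupAlg V G (κ z x), vec G y⁆ = 0

variable (V G) in
theorem grade_mul_grade_le (i j : ℕ) : grade V G i * grade V G j ≤ grade V G (i + j) :=
  Submodule.mul_le.2 fun _ ha _ hc => SetLike.mul_mem_graded ha hc

theorem word_mem_grade (l : List V) : word G l ∈ grade V G l.length := by
  simpa only [map_one, mul_one] using word_mul_grp_mem_grade l (1 : G)

theorem vec_mul_vec_mem_grade_two (x y : V) : vec G x * vec G y ∈ grade V G 2 := by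
  simpa using word_mem_grade (G := G) [x, y]

theorem relatorSpan_le : relatorSpan κ ≤ grade V G 2 ⊔ grade V G 0 := by
  refine Submodule.map₂_le.2 fun x _ y _ => ?_
  rw [relator_apply]
  exact Submodule.sub_mem_sup
    (sub_mem (vec_mul_vec_mem_grade_two x y) (vec_mul_vec_mem_grade_two y x))
    (groupAlg_mem_grade_zero _)

theorem grade_mul_relatorSpan_mul_grade_le_degLT {i j n : ℕ} (h : i + j + 2 < n) :
    grade V G i * relatorSpan κ * grade V G j ≤ degLT V G n := by
  have grade_mul_mul_le {k : ℕ} (hk : i + k + j < n) :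
      grade V G i * grade V G k * grade V G j ≤ degLT V G n :=
    (mul_le_mul' (grade_mul_grade_le V G i k) le_rfl).trans
      ((grade_mul_grade_le V G _ j).trans (grade_le_degLT hk))
  calc grade V G i * relatorSpan κ * grade V G j
      ≤ grade V G i * (grade V G 2 ⊔ grade V G 0) * grade V G j :=
        mul_le_mul' (mul_le_mul' le_rfl (relatorSpan_le κ)) le_rfl
    _ ≤ degLT V G n := by
      rw [Submodule.mul_sup, Submodule.sup_mul]
      exact sup_le (grade_mul_mul_le (by lia)) (grade_mul_mul_le (by lia))

variable {κ} {M : Type*} [AddCommGroup M] [Module ℂ M] {Φ : SmashTensor V G →ₗ[ℂ] M} {n : ℕ}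

theorem map_vec_mul_vec (hΦ : relations κ n ≤ LinearMap.ker Φ) {i j : ℕ} (hij : i + j + 2 < n)
    {a c : SmashTensor V G} (ha : a ∈ grade V G i) (hc : c ∈ grade V G j) (x y : V) :
    Φ (a * (vec G x * (vec G y * c))) =
      Φ (a * (vec G y * (vec G x * c))) + Φ (a * (groupAlg V G (κ x y) * c)) := by
  have relator_mem : a * relator κ x y * c ∈ relations κ n :=
    Submodule.mem_iSup_of_mem (i, j) (Submodule.mem_iSup_of_mem hij (Submodule.mul_mem_mul
      (Submodule.mul_mem_mul ha (Submodule.apply_mem_map₂ _ trivial trivial)) hc))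
  have map_relator := LinearMap.mem_ker.1 (hΦ relator_mem)
  rw [relator_apply, mul_sub, mul_sub, sub_mul, sub_mul, map_sub, map_sub, sub_sub,
    sub_eq_zero] at map_relator
  simpa only [mul_assoc] using map_relator

theorem map_groupAlg_neg (Φ : SmashTensor V G →ₗ[ℂ] M) (a c : SmashTensor V G)
    (k : MonoidAlgebra ℂ G) :
    Φ (a * (groupAlg V G (-k) * c)) = -Φ (a * (groupAlg V G k * c)) :=
  map_neg (Φ ∘ₗ LinearMap.mulLeft ℂ a ∘ₗ LinearMap.mulRight ℂ c ∘ₗ (groupAlg V G).toLinearMap) k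

theorem SatisfiesJacobi.map_braid (hJ : SatisfiesJacobi κ) (hκ_alt : κ.IsAlt)
    (Φ : SmashTensor V G →ₗ[ℂ] M) (a c : SmashTensor V G) (x y z : V) :
    Φ (a * (groupAlg V G (κ x y) * (vec G z * c))) +
        Φ (a * (vec G y * (groupAlg V G (κ x z) * c))) +
        Φ (a * (groupAlg V G (κ y z) * (vec G x * c))) =
      Φ (a * (vec G x * (groupAlg V G (κ y z) * c))) +
        Φ (a * (groupAlg V G (κ x z) * (vec G y * c))) +
        Φ (a * (vec G z * (groupAlg V G (κ x y) * c))) := by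
  have jacobi := congrArg (fun r => Φ (a * (r * c))) (hJ x y z)
  have neg_left := map_groupAlg_neg Φ (a * vec G y) c (κ z x)
  have neg_right := map_groupAlg_neg Φ a (vec G y * c) (κ z x)
  simp only [Ring.lie_def, add_mul, sub_mul, mul_add, mul_sub, map_add, map_sub, zero_mul,
    mul_zero, map_zero, mul_assoc] at jacobi neg_left neg_right
  rw [← hκ_alt.neg z x, neg_left, neg_right, ← sub_eq_zero, ← jacobi]
  abel

variable (κ Φ) in
/-- The value that the relation `[bᵢ, bⱼ] = κ(bᵢ, bⱼ)` prescribes for the increment of `Φ` from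
`u bⱼ bᵢ v g` to `u bᵢ bⱼ v g`, where `u` and `v` are words in a basis `b` of `V`. -/
def swapValue {ι : Type*} (b : Module.Basis ι ℂ V) (g : G) (u : List ι) (i j : ι) (v : List ι) :
    M :=
  Φ (word G (u.map b) * (groupAlg V G (κ (b i) (b j)) * (word G (v.map b) * grp V g)))

theorem swapValue_far (hΦ : relations κ n ≤ LinearMap.ker Φ) {ι : Type*} (b : Module.Basis ι ℂ V)
    (g : G) (u : List ι) (i j : ι) (v : List ι) (k l : ι) (w : List ι)
    (hlen : u.length + v.length + w.length + 4 = n) :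
    swapValue κ Φ b g u i j (v ++ k :: l :: w) + swapValue κ Φ b g (u ++ j :: i :: v) k l w =
      swapValue κ Φ b g (u ++ i :: j :: v) k l w + swapValue κ Φ b g u i j (v ++ l :: k :: w) := by
  have mem_u : word G (u.map b) ∈ grade V G u.length := by
    simpa using word_mem_grade (G := G) (u.map b)
  have mem_v : word G (v.map b) ∈ grade V G v.length := by
    simpa using word_mem_grade (G := G) (v.map b)
  have mem_w : word G (w.map b) * grp V g ∈ grade V G w.length := by
    simpa using word_mul_grp_mem_grade (w.map b) g
  have swap_kl := map_vec_mul_vec hΦ (by lia) (SetLike.mul_mem_graded mem_u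
    (SetLike.mul_mem_graded (groupAlg_mem_grade_zero (κ (b i) (b j))) mem_v)) mem_w (b k) (b l)
  have swap_ij := map_vec_mul_vec hΦ (by lia) mem_u (SetLike.mul_mem_graded mem_v
    (SetLike.mul_mem_graded (groupAlg_mem_grade_zero (κ (b k) (b l))) mem_w)) (b i) (b j)
  simp only [swapValue, List.map_append, List.map_cons, word_append, word_cons, mul_assoc]
    at swap_kl swap_ij ⊢
  rw [swap_kl, swap_ij]
  abel

theorem isSwapCocycle_swapValue (hκ_alt : κ.IsAlt) (hJ : SatisfiesJacobi κ)
    (hΦ : relations κ n ≤ LinearMap.ker Φ) {ι : Type*} (b : Module.Basis ι ℂ V) (g : G) :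
    IsSwapCocycle n (swapValue κ Φ b g) where
  self u i v _ := by simp only [swapValue, hκ_alt (b i), map_zero, zero_mul, mul_zero]
  anti u i j v _ := by rw [swapValue, ← hκ_alt.neg, map_groupAlg_neg, swapValue]
  far := swapValue_far hΦ b g
  braid u i j k v _ := by
    simpa only [swapValue, List.map_append, List.map_cons, List.map_nil, word_append, word_cons,
      word_nil, mul_one, mul_assoc] using
      hJ.map_braid hκ_alt Φ (word G (u.map b)) (word G (v.map b) * grp V g) (b i) (b j) (b k)

theorem exists_eqOn_degLT_map_swap (hκ_alt : κ.IsAlt) (hJ : SatisfiesJacobi κ)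
    (hΦ : relations κ n ≤ LinearMap.ker Φ) {ι : Type*} [LinearOrder ι] (b : Module.Basis ι ℂ V) :
    ∃ Φ' : SmashTensor V G →ₗ[ℂ] M, Set.EqOn Φ' Φ (degLT V G n) ∧
      ∀ u i j v g, u.length + v.length + 2 = n →
        Φ' (word G ((u ++ i :: j :: v).map b) * grp V g) =
          Φ' (word G ((u ++ j :: i :: v).map b) * grp V g) + swapValue κ Φ b g u i j v := by
  choose ψ hψ using fun g : G => (isSwapCocycle_swapValue hκ_alt hJ hΦ b g).exists_potential
  let Θ := (wordBasis G b).constr ℂ fun p => ψ p.2 p.1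
  obtain ⟨Φ', hΦ'⟩ := exists_linearMap_eqOn_grade fun k => if k = n then Θ else Φ
  refine ⟨Φ', ?_, fun u i j v g hlen => ?_⟩
  · suffices degLT V G n ≤ LinearMap.eqLocus Φ' Φ from this
    exact iSup₂_le fun k hk a ha => (hΦ' k a ha).trans (by rw [if_neg hk.ne])
  · have map_word (w : List ι) (hw : w.length = n) :
        Φ' (word G (w.map b) * grp V g) = ψ g w := by
      rw [hΦ' n _ (by simpa [hw] using word_mul_grp_mem_grade (w.map b) g), if_pos rfl,
        ← wordBasis_apply, (wordBasis G b).constr_basis]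
    rw [map_word _ (by simp; lia), map_word _ (by simp; lia)]
    exact hψ g u i j v hlen

theorem exists_extension_succ (hκ_alt : κ.IsAlt) (hκ : IsEquivariant κ) (hJ : SatisfiesJacobi κ)
    (hΦ : relations κ n ≤ LinearMap.ker Φ) :
    ∃ Φ' : SmashTensor V G →ₗ[ℂ] M, relations κ (n + 1) ≤ LinearMap.ker Φ' ∧
      Set.EqOn Φ' Φ (degLT V G n) := by
  let b := Module.Basis.ofVectorSpace ℂ V
  classical
  let := linearOrderOfSTO (WellOrderingRel (α := Module.Basis.ofVectorSpaceIndex ℂ V))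
  obtain ⟨Φ', eqOn, map_swap⟩ := exists_eqOn_degLT_map_swap hκ_alt hJ hΦ b
  refine ⟨Φ', iSup₂_le fun p hp => ?_, eqOn⟩
  rcases (Nat.lt_succ_iff.1 hp).lt_or_eq with hlt | heq
  · intro a ha
    rw [LinearMap.mem_ker, eqOn (grade_mul_relatorSpan_mul_grade_le_degLT κ hlt ha)]
    exact hΦ (Submodule.mem_iSup_of_mem p (Submodule.mem_iSup_of_mem hlt ha))
  · refine (hκ.grade_mul_relatorSpan_mul_grade_le b _ _).trans (Submodule.span_le.2 ?_)
    rintro _ ⟨u, v, hu, hv, k, l, g, rfl⟩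
    have map_groupAlg : Φ' (word G (u.map b) * (groupAlg V G (κ (b k) (b l)) *
        (word G (v.map b) * grp V g))) = swapValue κ Φ b g u k l v := by
      refine eqOn (grade_le_degLT (k := u.length + (0 + v.length)) (by lia)
        (SetLike.mul_mem_graded ?_ (SetLike.mul_mem_graded (groupAlg_mem_grade_zero _) ?_)))
      · simpa using word_mem_grade (G := G) (u.map b)
      · simpa using word_mul_grp_mem_grade (v.map b) g
    have swap := map_swap u k l v g (by lia)
    rw [← map_groupAlg] at swap
    rw [SetLike.mem_coe, LinearMap.mem_ker, relator_apply, mul_sub, mul_sub, sub_mul, sub_mul,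
      map_sub, map_sub, sub_sub, sub_eq_zero]
    simpa only [List.map_append, List.map_cons, word_append, word_cons, mul_assoc] using swap

theorem exists_extension (hκ_alt : κ.IsAlt) (hκ : IsEquivariant κ) (hJ : SatisfiesJacobi κ)
    (hΦ : relations κ n ≤ LinearMap.ker Φ) {N : ℕ} (hN : n ≤ N) :
    ∃ Φ' : SmashTensor V G →ₗ[ℂ] M, relations κ N ≤ LinearMap.ker Φ' ∧
      Set.EqOn Φ' Φ (degLT V G n) := by
  induction N, hN using Nat.le_induction with
  | base => exact ⟨Φ, hΦ, fun _ _ => rfl⟩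
  | succ N hN ih =>
    obtain ⟨Φ', hΦ', eqOn⟩ := ih
    obtain ⟨Φ'', hΦ'', eqOn'⟩ := exists_extension_succ hκ_alt hκ hJ hΦ'
    exact ⟨Φ'', hΦ'', (eqOn'.mono (degLT_mono hN)).trans eqOn⟩

end Extension

section ToSym

variable {V G : Type*} [AddCommGroup V] [Module ℂ V] [Group G]

theorem vec_apply (x : V) : vec G x = SkewMonoidAlgebra.single 1 (TensorAlgebra.ι ℂ x) := rfl

variable [DistribMulAction G V] [SMulCommClass G ℂ V]

theorem algHom_smul (g : G) (t : TensorAlgebra ℂ V) :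
    SymmetricAlgebra.algHom ℂ V (g • t) = g • SymmetricAlgebra.algHom ℂ V t := by
  induction t using TensorAlgebra.induction with
  | algebraMap r => rw [smul_algebraMap, AlgHom.commutes, smul_algebraMap]
  | ι x =>
    rw [smul_tensor_ι]
    exact (smul_sym_ι g x).symm
  | mul a b ha hb => rw [smul_mul', map_mul, map_mul, smul_mul', ha, hb]
  | add a b ha hb => rw [smul_add, map_add, map_add, smul_add, ha, hb]

variable (V G) in
/-- The homomorphism `G ⋉ T(V) → G ⋉ S(V)` induced by the projection `T(V) → S(V)`. -/
def toSym : SmashTensor V G →ₐ[ℂ] SmashSym V G :=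
  SkewMonoidAlgebra.liftNCAlgHom
    { toRingHom := SkewMonoidAlgebra.singleOneRingHom.comp
        (SymmetricAlgebra.algHom ℂ V : TensorAlgebra ℂ V →+* SymmetricAlgebra ℂ V)
      commutes' := fun r => congrArg SkewMonoidAlgebra.singleOneRingHom
        ((SymmetricAlgebra.algHom ℂ V).commutes r) }
    (SkewMonoidAlgebra.of (SymmetricAlgebra ℂ V) G) fun {t g} => by
      change SkewMonoidAlgebra.single 1 (SymmetricAlgebra.algHom ℂ V (g • t)) *
        SkewMonoidAlgebra.single g 1 =
          SkewMonoidAlgebra.single g 1 * SkewMonoidAlgebra.single 1 (SymmetricAlgebra.algHom ℂ V t)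
      simp only [SkewMonoidAlgebra.single_mul_single, algHom_smul, one_mul, mul_one, one_smul]

theorem toSym_single (g : G) (t : TensorAlgebra ℂ V) :
    toSym V G (SkewMonoidAlgebra.single g t) =
      SkewMonoidAlgebra.single g (SymmetricAlgebra.algHom ℂ V t) := by
  refine (SkewMonoidAlgebra.liftNC_single _ _ _ _).trans ?_
  change SkewMonoidAlgebra.single 1 _ * SkewMonoidAlgebra.single g 1 = _
  rw [SkewMonoidAlgebra.single_mul_single, one_mul, one_smul, mul_one]
  rfl

theorem coeff_toSym (a : SmashTensor V G) (g : G) :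
    (toSym V G a).coeff g = SymmetricAlgebra.algHom ℂ V (a.coeff g) := by
  classical
  induction a using SkewMonoidAlgebra.induction_on with
  | zero => simp
  | single h t => rw [toSym_single, SkewMonoidAlgebra.coeff_single_apply,
      SkewMonoidAlgebra.coeff_single_apply, apply_ite (SymmetricAlgebra.algHom ℂ V), map_zero]
  | add a c ha hc => simp [ha, hc]

theorem toSym_surjective : Function.Surjective (toSym V G) := by
  intro z
  induction z using SkewMonoidAlgebra.induction_on with
  | zero => exact ⟨0, map_zero _⟩
  | single g s =>
    obtain ⟨t, rfl⟩ := SymmetricAlgebra.algHom_surjective ℂ V s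
    exact ⟨_, toSym_single g t⟩
  | add y z hy hz =>
    obtain ⟨⟨a, rfl⟩, c, rfl⟩ := And.intro hy hz
    exact ⟨a + c, map_add _ a c⟩

theorem toSym_vec (x : V) :
    toSym V G (vec G x) = SkewMonoidAlgebra.single 1 (SymmetricAlgebra.ι ℂ V x) :=
  toSym_single 1 _

theorem toSym_grp (g : G) : toSym V G (grp V g) = SkewMonoidAlgebra.single g 1 :=
  (toSym_single g 1).trans (congrArg _ (map_one _))

theorem toSym_vec_mul_vec (x y : V) :
    toSym V G (vec G x * vec G y) = toSym V G (vec G y * vec G x) := by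
  simp only [map_mul, toSym_vec, SkewMonoidAlgebra.single_mul_single, one_smul, mul_comm]

theorem sym_ι_eq_zero {x : V} (hx : SymmetricAlgebra.ι ℂ V x = 0) : x = 0 := by
  rw [← Module.forall_dual_apply_eq_zero_iff ℂ]
  intro φ
  rw [← SymmetricAlgebra.lift_ι_apply φ, hx, map_zero]

theorem coeff_groupAlg (k : MonoidAlgebra ℂ G) (g : G) :
    (groupAlg V G k).coeff g = algebraMap ℂ (TensorAlgebra ℂ V) (k.coeff g) := by
  classical
  induction k using MonoidAlgebra.induction_on with
  | of h =>
    rw [groupAlg_of, SkewMonoidAlgebra.of_apply, SkewMonoidAlgebra.coeff_single_apply,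
      MonoidAlgebra.of_apply, MonoidAlgebra.coeff_single, Finsupp.single_apply,
      apply_ite (algebraMap ℂ _), map_one, map_zero]
  | add k l hk hl => simp [hk, hl]
  | smul r k hk =>
    rw [map_smul, SkewMonoidAlgebra.coeff_smul, MonoidAlgebra.coeff_smul, Finsupp.smul_apply,
      Finsupp.smul_apply, hk, smul_eq_mul, map_mul, Algebra.smul_def]

theorem groupAlg_eq_zero_of_toSym_eq_zero {k : MonoidAlgebra ℂ G}
    (hk : toSym V G (groupAlg V G k) = 0) : k = 0 := by
  ext g
  have coeff_eq := coeff_toSym (groupAlg V G k) g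
  rw [hk, coeff_groupAlg, AlgHom.commutes, SkewMonoidAlgebra.coeff_zero, Finsupp.zero_apply,
    eq_comm, SymmetricAlgebra.algebraMap_eq_zero_iff] at coeff_eq
  simpa using coeff_eq

theorem coeff_lie_groupAlg_vec (k : MonoidAlgebra ℂ G) (z : V) (g : G) :
    ⁅groupAlg V G k, vec G z⁆.coeff g = TensorAlgebra.ι ℂ (k.coeff g • (g • z - z)) := by
  have coeff_mul_vec :
      (groupAlg V G k * vec G z).coeff g = TensorAlgebra.ι ℂ (k.coeff g • (g • z)) := by
    rw [vec_apply, SkewMonoidAlgebra.coeff_mul_single_one, coeff_groupAlg, smul_tensor_ι,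
      ← Algebra.smul_def, LinearMap.map_smul]
  have coeff_vec_mul :
      (vec G z * groupAlg V G k).coeff g = TensorAlgebra.ι ℂ (k.coeff g • z) := by
    rw [vec_apply, SkewMonoidAlgebra.coeff_single_one_mul, coeff_groupAlg, ← Algebra.commutes,
      ← Algebra.smul_def, LinearMap.map_smul]
  rw [Ring.lie_def, SkewMonoidAlgebra.coeff_sub, Finsupp.sub_apply, coeff_mul_vec, coeff_vec_mul,
    smul_sub, map_sub]

end ToSym

section PBW

variable {V G : Type*} [AddCommGroup V] [Module ℂ V] [Group G] [DistribMulAction G V]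
  [SMulCommClass G ℂ V] (κ : V →ₗ[ℂ] V →ₗ[ℂ] MonoidAlgebra ℂ G)

theorem coeff_jacobi (x y z : V) (g : G) :
    (⁅groupAlg V G (κ x y), vec G z⁆ + ⁅groupAlg V G (κ y z), vec G x⁆ +
      ⁅groupAlg V G (κ z x), vec G y⁆).coeff g =
      TensorAlgebra.ι ℂ ((κ x y).coeff g • (g • z - z) + (κ y z).coeff g • (g • x - x) +
        (κ z x).coeff g • (g • y - y)) := by
  simp only [SkewMonoidAlgebra.coeff_add, Finsupp.add_apply, coeff_lie_groupAlg_vec, map_add]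

theorem xi_toSym_word (l : List V) (h : proj κ (word G l) ∈ filt κ l.length) :
    xi κ (toSym V G (word G l)) = symbol (filt κ) l.length ⟨_, h⟩ := by
  induction l with
  | nil =>
    refine Eq.trans ?_ ((symbol_one (filt κ)).symm.trans (symbol_congr _ rfl (map_one _).symm))
    rw [word_nil, map_one, map_one]
  | cons x l ih =>
    have mem := proj_mem_filt κ (word_mem_grade l)
    refine Eq.trans ?_ ((symbol_mul (filt κ) ⟨_, vec_mem κ x⟩ ⟨_, mem⟩).trans
      (symbol_congr _ (add_comm _ _) (map_mul _ _ _).symm))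
    rw [word_cons, map_mul, map_mul, ih mem, toSym_vec, xi_vec]
    rfl

theorem xi_toSym {n : ℕ} {a : SmashTensor V G} (ha : a ∈ grade V G n) :
    xi κ (toSym V G a) = symbol (filt κ) n ⟨proj κ a, proj_mem_filt κ ha⟩ := by
  induction ha using Submodule.span_induction with
  | zero =>
    rw [map_zero, map_zero]
    exact (map_zero (symbol (filt κ) n)).symm.trans (symbol_congr _ rfl (map_zero _).symm)
  | add a c ha hc iha ihc =>
    rw [map_add, map_add, iha, ihc, ← map_add]
    exact symbol_congr _ rfl (map_add _ _ _).symm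
  | smul r a ha ih =>
    rw [map_smul, map_smul, ih, ← map_smul]
    exact symbol_congr _ rfl (map_smul _ _ _).symm
  | mem a ha =>
    obtain ⟨l, rfl, g, rfl⟩ := ha
    rw [map_mul, map_mul, xi_toSym_word κ l (proj_mem_filt κ (word_mem_grade l)), toSym_grp, xi_grp]
    exact (symbol_mul (filt κ) ⟨_, _⟩ ⟨_, of_mem κ g⟩).trans
      (symbol_congr _ (add_zero _) (map_mul _ _ _).symm)

theorem mem_prevStep_of_sum_symbol_eq_zero {s : Finset ℕ} (a : ∀ k, filt κ k)
    (h : ∑ k ∈ s, symbol (filt κ) k (a k) = 0) {n : ℕ} (hn : n ∈ s) :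
    (a n : H κ) ∈ prevStep (filt κ) n := by
  have component := congrArg (DirectSum.component ℂ ℕ (GrPiece (filt κ)) n) h
  have eq_zero (k : ℕ) (_ : k ∈ s) (hk : k ≠ n) :
      DirectSum.component ℂ ℕ (GrPiece (filt κ)) n (symbol (filt κ) k (a k)) = 0 :=
    (DirectSum.component.of ℂ n k _).trans (dif_neg hk)
  rw [map_sum, Finset.sum_eq_single_of_mem n hn eq_zero, map_zero] at component
  exact (Submodule.Quotient.mk_eq_zero ((prevStep (filt κ) n).submoduleOf (filt κ n))).1
    ((DirectSum.component.lof_self ℂ n _).symm.trans component)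

theorem injective_xi_iff : Function.Injective (xi κ) ↔
    ∀ n, ∀ a ∈ grade V G n, proj κ a ∈ prevStep (filt κ) n → toSym V G a = 0 := by
  rw [injective_iff_map_eq_zero]
  refine ⟨fun h n a ha hproj => h _ ((xi_toSym κ ha).trans (symbol_eq_zero _ hproj)),
    fun h z hz => ?_⟩
  obtain ⟨a, rfl⟩ := toSym_surjective z
  obtain ⟨f, hf, rfl⟩ := (Submodule.mem_iSup_iff_exists_finsupp (grade V G) a).1
    (iSup_grade V G ▸ Submodule.mem_top)
  rw [Finsupp.sum, map_sum] at hz ⊢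
  rw [map_sum, Finset.sum_congr rfl fun k _ => xi_toSym κ (hf k)] at hz
  exact Finset.sum_eq_zero fun n hn => h n _ (hf n)
    (mem_prevStep_of_sum_symbol_eq_zero κ (fun k => ⟨proj κ (f k), proj_mem_filt κ (hf k)⟩) hz hn)

variable {κ}

theorem proj_groupAlg (x y : V) :
    proj κ (groupAlg V G (κ x y)) = ⁅proj κ (vec G x), proj κ (vec G y)⁆ :=
  (proj_rel κ x y).symm

theorem isAlt_of_injective_xi (h : Function.Injective (xi κ)) : κ.IsAlt := fun x => by
  refine groupAlg_eq_zero_of_toSym_eq_zero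
    ((injective_xi_iff κ).1 h 0 _ (groupAlg_mem_grade_zero _) ?_)
  rw [proj_groupAlg, Ring.lie_def, sub_self]
  exact zero_mem _

theorem isEquivariant_of_injective_xi (h : Function.Injective (xi κ)) : IsEquivariant κ :=
  fun g x y => by
  refine sub_eq_zero.1 (groupAlg_eq_zero_of_toSym_eq_zero
    ((injective_xi_iff κ).1 h 0 _ (groupAlg_mem_grade_zero _) ?_))
  have conj (x : V) : proj κ (vec G (g • x)) =
      proj κ (grp V g) * proj κ (vec G x) * proj κ (grp V g⁻¹) := by
    rw [← map_mul, ← map_mul, of_mul_vec, mul_assoc, ← map_mul, mul_inv_cancel, map_one, mul_one]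
  have inv_mul : proj κ (grp V g⁻¹) * proj κ (grp V g) = 1 := by
    rw [← map_mul, ← map_mul, inv_mul_cancel, map_one, map_one]
  have proj_eq_zero : proj κ (groupAlg V G (κ (g • x) (g • y) -
      MonoidAlgebra.of ℂ G g * κ x y * MonoidAlgebra.of ℂ G g⁻¹)) = 0 := by
    rw [map_sub, map_sub, map_mul, map_mul, map_mul, map_mul, proj_groupAlg, proj_groupAlg, conj,
      conj, groupAlg_of, groupAlg_of, sub_eq_zero, Ring.lie_def, Ring.lie_def]
    have cancel (c : H κ) : proj κ (grp V g⁻¹) * (proj κ (grp V g) * c) = c := by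
      rw [← mul_assoc, inv_mul, one_mul]
    simp only [mul_assoc, mul_sub, sub_mul, cancel]
  rw [proj_eq_zero]
  exact zero_mem _

theorem satisfiesJacobi_of_injective_xi (h : Function.Injective (xi κ)) : SatisfiesJacobi κ :=
  fun x y z => by
  have lie_mem (k : MonoidAlgebra ℂ G) (z : V) : ⁅groupAlg V G k, vec G z⁆ ∈ grade V G 1 := by
    have mul_mem :=
      SetLike.mul_mem_graded (groupAlg_mem_grade_zero k) (vec_mem_grade_one (G := G) z)
    have mul_mem' := SetLike.mul_mem_graded (vec_mem_grade_one z) (groupAlg_mem_grade_zero k)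
    rw [zero_add] at mul_mem
    rw [add_zero] at mul_mem'
    exact sub_mem mul_mem mul_mem'
  have proj_eq_zero : proj κ (⁅groupAlg V G (κ x y), vec G z⁆ + ⁅groupAlg V G (κ y z), vec G x⁆ +
      ⁅groupAlg V G (κ z x), vec G y⁆) = 0 := by
    simp only [map_add, Ring.lie_def, map_sub, map_mul, proj_groupAlg]
    noncomm_ring
  have toSym_eq_zero := (injective_xi_iff κ).1 h 1 _
    (add_mem (add_mem (lie_mem (κ x y) z) (lie_mem (κ y z) x)) (lie_mem (κ z x) y))
    (proj_eq_zero ▸ zero_mem _)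
  ext g
  have coeff_eq := coeff_toSym (⁅groupAlg V G (κ x y), vec G z⁆ + ⁅groupAlg V G (κ y z), vec G x⁆ +
      ⁅groupAlg V G (κ z x), vec G y⁆) g
  rw [toSym_eq_zero, coeff_jacobi] at coeff_eq
  rw [coeff_jacobi, sym_ι_eq_zero coeff_eq.symm, map_zero]
  rfl

theorem relations_le {n : ℕ} {P : Submodule ℂ (SmashTensor V G)}
    (h : ∀ i j, i + j + 2 < n → ∀ a ∈ grade V G i, ∀ c ∈ grade V G j, ∀ x y : V,
      a * relator κ x y * c ∈ P) : relations κ n ≤ P := by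
  refine iSup₂_le fun p hp => Submodule.mul_le.2 fun r hr c hc => ?_
  suffices grade V G p.1 * relatorSpan κ ≤ P.comap (LinearMap.mulRight ℂ c) from this hr
  refine Submodule.mul_le.2 fun a ha s hs => ?_
  suffices relatorSpan κ ≤ (P.comap (LinearMap.mulRight ℂ c)).comap (LinearMap.mulLeft ℂ a)
    from this hs
  exact Submodule.map₂_le.2 fun x _ y _ => h p.1 p.2 hp a ha c hc x y

variable (κ) in
/-- Only the leading part `[x, y]` of a relation of degree `n` has degree `n`, and it vanishes in
`S(V)`. -/
theorem exists_toSym_component (n : ℕ) : ∃ Φ : SmashTensor V G →ₗ[ℂ] SmashSym V G,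
    Set.EqOn Φ (toSym V G) (grade V G n) ∧ degLT V G n ≤ LinearMap.ker Φ ∧
      relations κ (n + 1) ≤ LinearMap.ker Φ := by
  obtain ⟨Φ, hΦ⟩ := exists_linearMap_eqOn_grade fun k =>
    if k = n then (toSym V G).toLinearMap else 0
  have eqOn : Set.EqOn Φ (toSym V G) (grade V G n) := fun a ha => by rw [hΦ n a ha, if_pos rfl]; rfl
  have eq_zero {k : ℕ} (hk : k ≠ n) {a : SmashTensor V G} (ha : a ∈ grade V G k) : Φ a = 0 := by
    rw [hΦ k a ha, if_neg hk, LinearMap.zero_apply]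
  refine ⟨Φ, eqOn, iSup₂_le fun k hk a ha => eq_zero hk.ne ha,
    relations_le fun i j hij a ha c hc x y => ?_⟩
  have mem_vec_mul_vec (x y : V) : a * (vec G x * vec G y) * c ∈ grade V G (i + 2 + j) :=
    SetLike.mul_mem_graded (SetLike.mul_mem_graded ha (vec_mul_vec_mem_grade_two x y)) hc
  have mem_groupAlg : a * groupAlg V G (κ x y) * c ∈ grade V G (i + 0 + j) :=
    SetLike.mul_mem_graded (SetLike.mul_mem_graded ha (groupAlg_mem_grade_zero _)) hc
  rw [LinearMap.mem_ker, relator_apply, mul_sub, mul_sub, sub_mul, sub_mul, map_sub, map_sub,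
    eq_zero (by lia) mem_groupAlg, sub_zero, sub_eq_zero]
  by_cases hn : i + 2 + j = n
  · rw [eqOn (hn ▸ mem_vec_mul_vec x y), eqOn (hn ▸ mem_vec_mul_vec y x)]
    simp only [map_mul _ (_ * _) c, map_mul _ a, toSym_vec_mul_vec x y]
  · rw [eq_zero hn (mem_vec_mul_vec x y), eq_zero hn (mem_vec_mul_vec y x)]

theorem toSym_eq_zero_of_proj_mem (hκ_alt : κ.IsAlt) (hκ : IsEquivariant κ)
    (hJ : SatisfiesJacobi κ) {n : ℕ} {a : SmashTensor V G} (ha : a ∈ grade V G n)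
    (hproj : proj κ a ∈ prevStep (filt κ) n) : toSym V G a = 0 := by
  rw [← map_proj_degLT] at hproj
  obtain ⟨c, hc, hca⟩ := hproj
  obtain ⟨N, hN⟩ := exists_mem_relations κ (a := a - c) (by
    rw [map_sub, sub_eq_zero]
    exact hca.symm)
  obtain ⟨Φ, hΦ, hΦ_degLT, hΦ_relations⟩ := exists_toSym_component κ n
  obtain ⟨Ψ, hΨ_relations, hΨ⟩ :=
    exists_extension hκ_alt hκ hJ hΦ_relations (le_max_left (n + 1) N)
  calc toSym V G a = Φ a := (hΦ ha).symm
    _ = Ψ a := (hΨ (grade_le_degLT n.lt_succ_self ha)).symm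
    _ = Ψ c := by
      rw [← sub_eq_zero, ← map_sub]
      exact hΨ_relations (relations_mono κ (le_max_right _ _) hN)
    _ = Φ c := hΨ (degLT_mono n.le_succ hc)
    _ = 0 := hΦ_degLT hc

variable (κ) in
theorem bijective_xi_iff :
    Function.Bijective (xi κ) ↔ κ.IsAlt ∧ IsEquivariant κ ∧ SatisfiesJacobi κ :=
  ⟨fun h => ⟨isAlt_of_injective_xi h.1, isEquivariant_of_injective_xi h.1,
      satisfiesJacobi_of_injective_xi h.1⟩,
    fun ⟨hκ_alt, hκ, hJ⟩ => ⟨(injective_xi_iff κ).2 fun _ _ ha hproj =>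
      toSym_eq_zero_of_proj_mem hκ_alt hκ hJ ha hproj, xi_surjective κ⟩⟩

end PBW

section JacobiForm

variable {K V W : Type*} [Field K] [AddCommGroup V] [Module K V] [AddCommGroup W] [Module K W]
  {B ω : LinearMap.BilinForm K V} {A : V →ₗ[K] W}

/-- The Jacobi identity for the component of `κ` at a group element `g`: there `B` is the component
and `A` is `1 - g`. -/
def IsJacobi (B : LinearMap.BilinForm K V) (A : V →ₗ[K] W) : Prop :=
  ∀ x y z, B x y • A z + B y z • A x + B z x • A y = 0

theorem IsJacobi.smul (hB : IsJacobi B A) (a : K) : IsJacobi (a • B) A := fun x y z => by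
  simp only [LinearMap.smul_apply, smul_assoc, ← smul_add, hB x y z, smul_zero]

theorem IsJacobi.map_mem_span_pair (hB : IsJacobi B A) {x y : V} (hxy : B x y ≠ 0) (z : V) :
    A z ∈ Submodule.span K {A x, A y} := by
  have smul_mem : B x y • A z ∈ Submodule.span K {A x, A y} :=
    Submodule.mem_span_pair.2 ⟨-B y z, -B z x, by
      rw [neg_smul, neg_smul, ← sub_eq_zero, ← neg_eq_zero, ← hB x y z]
      abel⟩
  exact (Submodule.smul_mem_iff _ hxy).1 smul_mem

theorem IsJacobi.range_eq_span_pair (hB : IsJacobi B A) {x y : V} (hxy : B x y ≠ 0) :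
    LinearMap.range A = Submodule.span K {A x, A y} := by
  refine le_antisymm (LinearMap.range_le_iff_comap.2 (eq_top_iff.2 fun z _ =>
    hB.map_mem_span_pair hxy z)) (Submodule.span_le.2 ?_)
  rintro _ (rfl | rfl)
  · exact LinearMap.mem_range_self A x
  · exact LinearMap.mem_range_self A y

theorem IsJacobi.apply_eq_zero_of_mem_ker (hB : IsJacobi B A)
    (hA : 1 < Module.finrank K (LinearMap.range A)) (x : V) {z : V} (hz : z ∈ LinearMap.ker A) :
    B x z = 0 := by
  by_contra hxz
  have range_eq := hB.range_eq_span_pair hxz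
  rw [LinearMap.mem_ker.1 hz, Set.pair_comm, Submodule.span_insert_zero] at range_eq
  rw [range_eq] at hA
  exact hA.not_ge ((finrank_span_le_card {A x}).trans (by simp))

theorem apply_smul_add_smul (hB : B.IsAlt) (p q : V) (a b c d : K) :
    B (a • p + b • q) (c • p + d • q) = (a * d - b * c) * B p q := by
  simp only [map_add, map_smul, LinearMap.add_apply, LinearMap.smul_apply, smul_eq_mul, hB p, hB q,
    ← hB.neg_eq p q]
  ring

theorem apply_mem_span_pair (hω : ω.IsAlt) (hB : B.IsAlt) {p q x y : V} (hpq : ω p q ≠ 0)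
    (hx : x ∈ Submodule.span K {p, q}) (hy : y ∈ Submodule.span K {p, q}) :
    B x y = B p q / ω p q * ω x y := by
  obtain ⟨a, b, rfl⟩ := Submodule.mem_span_pair.1 hx
  obtain ⟨c, d, rfl⟩ := Submodule.mem_span_pair.1 hy
  rw [apply_smul_add_smul hB, apply_smul_add_smul hω]
  field_simp

theorem apply_eq_zero_of_mem_span_pair (hω : ω.IsAlt) {p q x y : V} (hpq : ω p q = 0)
    (hx : x ∈ Submodule.span K {p, q}) (hy : y ∈ Submodule.span K {p, q}) : ω x y = 0 := by
  obtain ⟨a, b, rfl⟩ := Submodule.mem_span_pair.1 hx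
  obtain ⟨c, d, rfl⟩ := Submodule.mem_span_pair.1 hy
  rw [apply_smul_add_smul hω, hpq, mul_zero]

theorem linearIndependent_pair_of_apply_ne_zero (hω : ω.IsAlt) {p q : V} (hpq : ω p q ≠ 0) :
    LinearIndependent K ![p, q] := by
  refine LinearIndependent.pair_iff.2 fun a b h => ?_
  have left : ω (a • p + b • q) q = a * ω p q := by simp [hω q]
  have right : ω p (a • p + b • q) = b * ω p q := by simp [hω p]
  rw [h, map_zero, LinearMap.zero_apply, eq_comm] at left
  rw [h, map_zero, eq_comm] at right
  exact ⟨(mul_eq_zero.1 left).resolve_right hpq, (mul_eq_zero.1 right).resolve_right hpq⟩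

theorem finrank_span_pair_of_apply_ne_zero (hω : ω.IsAlt) {p q : V} (hpq : ω p q ≠ 0) :
    Module.finrank K (Submodule.span K {p, q}) = 2 := by
  have finrank_eq := finrank_span_eq_card (linearIndependent_pair_of_apply_ne_zero hω hpq)
  rwa [Matrix.range_cons_cons_empty, Fintype.card_fin] at finrank_eq

theorem exists_eq_span_pair_of_finrank_eq_two {U : Submodule K V} (hU : Module.finrank K U = 2) :
    ∃ p q, U = Submodule.span K {p, q} := by
  have : Module.Finite K U := Module.finite_of_finrank_pos (hU ▸ two_pos)
  have b := Module.finBasisOfFinrankEq K U hU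
  refine ⟨b 0, b 1, ?_⟩
  have map_span := congrArg (Submodule.map U.subtype) b.span_eq
  rw [Submodule.map_span, Submodule.map_top, Submodule.range_subtype, ← Set.range_comp] at map_span
  refine map_span.symm.trans (congrArg _ ?_)
  ext v
  simp [Fin.exists_fin_two, eq_comm]

/-- An alternating form on a plane is a multiple of the determinant. -/
theorem cyclic_sum_smul_eq_zero_of_mem_span_pair (hB : B.IsAlt) {p q x y z : V}
    (hx : x ∈ Submodule.span K {p, q}) (hy : y ∈ Submodule.span K {p, q})
    (hz : z ∈ Submodule.span K {p, q}) : B x y • z + B y z • x + B z x • y = 0 := by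
  obtain ⟨x₁, x₂, rfl⟩ := Submodule.mem_span_pair.1 hx
  obtain ⟨y₁, y₂, rfl⟩ := Submodule.mem_span_pair.1 hy
  obtain ⟨z₁, z₂, rfl⟩ := Submodule.mem_span_pair.1 hz
  simp only [apply_smul_add_smul hB]
  module

end JacobiForm

section Reflections

variable {V G : Type*} [AddCommGroup V] [Module ℂ V] [Group G] [DistribMulAction G V]
  [SMulCommClass G ℂ V]

theorem oneSub_apply (g : G) (x : V) : oneSub V g x = x - g • x := rfl

theorem oneSub_one : oneSub V (1 : G) = 0 := by
  ext x
  rw [oneSub_apply, one_smul, sub_self, LinearMap.zero_apply]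

theorem mem_ker_oneSub {g : G} {x : V} : x ∈ LinearMap.ker (oneSub V g) ↔ g • x = x := by
  rw [LinearMap.mem_ker, oneSub_apply, sub_eq_zero, eq_comm]

theorem eq_one_of_oneSub_eq_zero [FaithfulSMul G V] {g : G} (hg : oneSub V g = 0) : g = 1 :=
  FaithfulSMul.eq_of_smul_eq_smul fun x : V => by
    rw [one_smul, ← mem_ker_oneSub, hg, LinearMap.ker_zero]
    exact Submodule.mem_top

theorem oneSub_conj (g h : G) (x : V) : oneSub V (h * g * h⁻¹) (h • x) = h • oneSub V g x := by
  simp only [oneSub_apply, smul_sub, mul_smul, inv_smul_smul]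

theorem oneSub_conj_comp (g h : G) :
    oneSub V (h * g * h⁻¹) ∘ₗ act V h = act V h ∘ₗ oneSub V g :=
  LinearMap.ext (oneSub_conj g h)

variable (V) in
theorem conj_mem_reflections_iff {s : G} (h : G) :
    h * s * h⁻¹ ∈ reflections V G ↔ s ∈ reflections V G := by
  have range_conj : LinearMap.range (oneSub V (h * s * h⁻¹)) =
      (LinearMap.range (oneSub V s)).map (act V h) := by
    rw [← LinearMap.range_comp, ← oneSub_conj_comp, LinearMap.range_comp_of_range_eq_top]
    exact LinearMap.range_eq_top.2 (MulAction.surjective h)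
  have finrank_eq : Module.finrank ℂ ((LinearMap.range (oneSub V s)).map (act V h)) =
      Module.finrank ℂ (LinearMap.range (oneSub V s)) :=
    (Submodule.equivMapOfInjective (act V h) (MulAction.injective h) _).finrank_eq.symm
  rw [← range_conj] at finrank_eq
  rw [reflections, Set.mem_ofPred_eq, Set.mem_ofPred_eq, finrank_eq]

variable {ω : LinearMap.BilinForm ℂ V}

theorem apply_eq_zero_of_mem_range_of_mem_ker
    (hω_inv : ∀ (g : G) (x y : V), ω (g • x) (g • y) = ω x y) {g : G} {p y : V}
    (hp : p ∈ LinearMap.range (oneSub V g)) (hy : y ∈ LinearMap.ker (oneSub V g)) : ω p y = 0 := by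
  obtain ⟨u, rfl⟩ := hp
  have inv := hω_inv g u y
  rw [mem_ker_oneSub.1 hy] at inv
  rw [oneSub_apply, map_sub, LinearMap.sub_apply, inv, sub_self]

variable [FiniteDimensional ℂ V] [Finite G]

variable (V) in
/-- The projection to the image of `1 - g` along its kernel. -/
abbrev rangeProj (g : G) : V →ₗ[ℂ] V :=
  (LinearMap.range (oneSub V g)).projection (LinearMap.ker (oneSub V g)) (isCompl_oneSub V g)

theorem rangeProj_mem (g : G) (x : V) : rangeProj V g x ∈ LinearMap.range (oneSub V g) :=
  Submodule.projection_apply_mem _ x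

theorem rangeProj_of_mem {g : G} {x : V} (hx : x ∈ LinearMap.range (oneSub V g)) :
    rangeProj V g x = x :=
  Submodule.projection_apply_of_mem_left _ hx

theorem sub_rangeProj_mem (g : G) (x : V) : x - rangeProj V g x ∈ LinearMap.ker (oneSub V g) :=
  Submodule.sub_projection_mem _ x

theorem oneSub_rangeProj (g : G) (x : V) : oneSub V g (rangeProj V g x) = oneSub V g x := by
  rw [eq_comm, ← sub_eq_zero, ← map_sub]
  exact sub_rangeProj_mem g x

theorem rangeProj_conj (g h : G) (x : V) :
    rangeProj V (h * g * h⁻¹) (h • x) = h • rangeProj V g x := by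
  have mem_range : h • rangeProj V g x ∈ LinearMap.range (oneSub V (h * g * h⁻¹)) := by
    obtain ⟨u, hu⟩ := rangeProj_mem g x
    exact ⟨h • u, by rw [oneSub_conj, hu]⟩
  have mem_ker : h • (x - rangeProj V g x) ∈ LinearMap.ker (oneSub V (h * g * h⁻¹)) := by
    rw [LinearMap.mem_ker, oneSub_conj, LinearMap.mem_ker.1 (sub_rangeProj_mem g x), smul_zero]
  calc rangeProj V (h * g * h⁻¹) (h • x)
      = rangeProj V (h * g * h⁻¹) (h • rangeProj V g x) +
          rangeProj V (h * g * h⁻¹) (h • (x - rangeProj V g x)) := by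
        rw [← map_add, ← smul_add, add_sub_cancel]
    _ = h • rangeProj V g x := by
        rw [rangeProj_of_mem mem_range, (Submodule.projection_apply_eq_zero_iff _).2 mem_ker,
          add_zero]

theorem omegaS_apply (ω : LinearMap.BilinForm ℂ V) (g : G) (x y : V) :
    omegaS ω g x y = ω (rangeProj V g x) (rangeProj V g y) := rfl

theorem omegaS_isAlt (hω : ω.IsAlt) (g : G) : (omegaS ω g).IsAlt :=
  fun x => hω (rangeProj V g x)

theorem omegaS_conj (hω_inv : ∀ (g : G) (x y : V), ω (g • x) (g • y) = ω x y) (g h : G) (x y : V) :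
    omegaS ω (h * g * h⁻¹) (h • x) (h • y) = omegaS ω g x y := by
  rw [omegaS_apply, omegaS_apply, rangeProj_conj, rangeProj_conj, hω_inv]

theorem oneSub_eq_zero_of_apply_range (hω_nondeg : ω.Nondegenerate)
    (hω_inv : ∀ (g : G) (x y : V), ω (g • x) (g • y) = ω x y) {g : G}
    (h : ∀ p ∈ LinearMap.range (oneSub V g), ∀ q ∈ LinearMap.range (oneSub V g), ω p q = 0) :
    oneSub V g = 0 := by
  ext x
  have hx := LinearMap.mem_range_self (oneSub V g) x
  refine hω_nondeg.1 _ fun y => ?_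
  rw [← add_sub_cancel (rangeProj V g y) y, map_add, h _ hx _ (rangeProj_mem g y),
    apply_eq_zero_of_mem_range_of_mem_ker hω_inv hx (sub_rangeProj_mem g y), add_zero]

theorem omegaS_ne_zero (hω_nondeg : ω.Nondegenerate)
    (hω_inv : ∀ (g : G) (x y : V), ω (g • x) (g • y) = ω x y) {s : G} (hs : s ∈ reflections V G) :
    omegaS ω s ≠ 0 := by
  intro h
  have oneSub_eq_zero : oneSub V s = 0 :=
    oneSub_eq_zero_of_apply_range hω_nondeg hω_inv fun p hp q hq => by
      rw [← rangeProj_of_mem hp, ← rangeProj_of_mem hq, ← omegaS_apply, h, LinearMap.zero_apply,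
        LinearMap.zero_apply]
  have finrank_eq : Module.finrank ℂ (LinearMap.range (oneSub V s)) = 2 := hs
  rw [oneSub_eq_zero, LinearMap.range_zero, finrank_bot] at finrank_eq
  exact two_ne_zero finrank_eq.symm

theorem isJacobi_omegaS (hω : ω.IsAlt) {s : G} (hs : s ∈ reflections V G) :
    IsJacobi (omegaS ω s) (oneSub V s) := fun x y z => by
  obtain ⟨p, q, range_eq⟩ := exists_eq_span_pair_of_finrank_eq_two hs
  have mem (v : V) : rangeProj V s v ∈ Submodule.span ℂ {p, q} := range_eq ▸ rangeProj_mem s v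
  simpa only [map_add, map_smul, map_zero, oneSub_rangeProj, ← omegaS_apply] using
    congrArg (oneSub V s) (cyclic_sum_smul_eq_zero_of_mem_span_pair hω (mem x) (mem y) (mem z))

theorem IsJacobi.map_ne_zero [FaithfulSMul G V] (hω : ω.IsAlt) (hω_nondeg : ω.Nondegenerate)
    (hω_inv : ∀ (g : G) (x y : V), ω (g • x) (g • y) = ω x y) {g : G} (hg : g ≠ 1)
    {B : LinearMap.BilinForm ℂ V} (hB : IsJacobi B (oneSub V g)) {x y : V} (hxy : B x y ≠ 0) :
    ω (oneSub V g x) (oneSub V g y) ≠ 0 := fun h =>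
  hg (eq_one_of_oneSub_eq_zero (oneSub_eq_zero_of_apply_range hω_nondeg hω_inv
    fun _ hp _ hq => apply_eq_zero_of_mem_span_pair hω h
      (hB.range_eq_span_pair hxy ▸ hp) (hB.range_eq_span_pair hxy ▸ hq)))

theorem IsJacobi.apply_rangeProj {g : G} {B : LinearMap.BilinForm ℂ V} (hB_alt : B.IsAlt)
    (hB : IsJacobi B (oneSub V g)) (hg : g ∈ reflections V G) (x y : V) :
    B (rangeProj V g x) (rangeProj V g y) = B x y := by
  have rank : 1 < Module.finrank ℂ (LinearMap.range (oneSub V g)) := hg.symm ▸ one_lt_two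
  have right (x y : V) : B x (rangeProj V g y) = B x y := by
    rw [eq_comm, ← sub_eq_zero, ← map_sub]
    exact hB.apply_eq_zero_of_mem_ker rank x (sub_rangeProj_mem g y)
  rw [right, ← hB_alt.neg_eq, right, hB_alt.neg_eq]

theorem IsJacobi.eq_zero_or_eq_smul_omegaS [FaithfulSMul G V] (hω : ω.IsAlt)
    (hω_nondeg : ω.Nondegenerate) (hω_inv : ∀ (g : G) (x y : V), ω (g • x) (g • y) = ω x y) {g : G}
    (hg : g ≠ 1) {B : LinearMap.BilinForm ℂ V} (hB_alt : B.IsAlt) (hB : IsJacobi B (oneSub V g)) :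
    B = 0 ∨ g ∈ reflections V G ∧ ∃ a : ℂ, B = a • omegaS ω g := by
  refine or_iff_not_imp_left.2 fun hB_ne => ?_
  obtain ⟨x, y, hxy⟩ : ∃ x y, B x y ≠ 0 := by
    by_contra! h
    exact hB_ne (LinearMap.ext₂ h)
  have range_eq := hB.range_eq_span_pair hxy
  have ω_ne_zero := hB.map_ne_zero hω hω_nondeg hω_inv hg hxy
  have hg_mem : g ∈ reflections V G :=
    (congrArg (fun U : Submodule ℂ V => Module.finrank ℂ U) range_eq).trans
      (finrank_span_pair_of_apply_ne_zero hω ω_ne_zero)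
  refine ⟨hg_mem, B (oneSub V g x) (oneSub V g y) / ω (oneSub V g x) (oneSub V g y),
    LinearMap.ext₂ fun u v => ?_⟩
  rw [← hB.apply_rangeProj hB_alt hg_mem, apply_mem_span_pair hω hB_alt ω_ne_zero
    (range_eq ▸ rangeProj_mem g u) (range_eq ▸ rangeProj_mem g v)]
  rfl

end Reflections

section CoeffForm

variable {V G : Type*} [AddCommGroup V] [Module ℂ V] {κ : V →ₗ[ℂ] V →ₗ[ℂ] MonoidAlgebra ℂ G}

variable (κ) in
/-- The component of `κ` at a group element. -/
def coeffForm (g : G) : LinearMap.BilinForm ℂ V :=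
  κ.compr₂ (Finsupp.lapply g ∘ₗ (MonoidAlgebra.coeffLinearEquiv ℂ).toLinearMap)

theorem coeffForm_apply (g : G) (x y : V) : coeffForm κ g x y = (κ x y).coeff g := rfl

theorem isAlt_iff_coeffForm : κ.IsAlt ↔ ∀ g, (coeffForm κ g).IsAlt := by
  refine ⟨fun h g x => ?_, fun h x => ?_⟩
  · rw [coeffForm_apply, h x, MonoidAlgebra.coeff_zero, Finsupp.zero_apply]
  · ext g
    exact h g x

variable [Group G] [DistribMulAction G V]

theorem isEquivariant_iff_coeffForm : IsEquivariant κ ↔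
    ∀ g h x y, coeffForm κ (h * g * h⁻¹) (h • x) (h • y) = coeffForm κ g x y := by
  have coeff_conj (k : MonoidAlgebra ℂ G) (g h : G) :
      (MonoidAlgebra.of ℂ G h * k * MonoidAlgebra.of ℂ G h⁻¹).coeff (h * g * h⁻¹) = k.coeff g := by
    simp [MonoidAlgebra.coeff_mul_single_apply, MonoidAlgebra.coeff_single_mul_apply, mul_assoc]
  refine ⟨fun hκ g h x y => ?_, fun hκ h x y => ?_⟩
  · rw [coeffForm_apply, coeffForm_apply, hκ h x y, coeff_conj]
  · ext g
    obtain ⟨g, rfl⟩ := (MulAut.conj h).surjective g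
    exact (hκ g h x y).trans (coeff_conj (κ x y) g h).symm

variable [SMulCommClass G ℂ V]

theorem satisfiesJacobi_iff_coeffForm :
    SatisfiesJacobi κ ↔ ∀ g, IsJacobi (coeffForm κ g) (oneSub V g) := by
  have neg_cyclic_sum (g : G) (x y z : V) :
      (κ x y).coeff g • (g • z - z) + (κ y z).coeff g • (g • x - x) +
        (κ z x).coeff g • (g • y - y) =
      -(coeffForm κ g x y • oneSub V g z + coeffForm κ g y z • oneSub V g x +
        coeffForm κ g z x • oneSub V g y) := by
    rw [oneSub_apply, oneSub_apply, oneSub_apply, ← neg_sub (g • z), ← neg_sub (g • x),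
      ← neg_sub (g • y), smul_neg, smul_neg, smul_neg, ← neg_add, ← neg_add, neg_neg]
    rfl
  refine ⟨fun h g x y z => ?_, fun h x y z => ?_⟩
  · rw [← neg_eq_zero, ← neg_cyclic_sum, ← TensorAlgebra.ι_eq_zero_iff ℂ, ← coeff_jacobi, h x y z]
    rfl
  · ext g
    rw [coeff_jacobi, neg_cyclic_sum, h g x y z, neg_zero, map_zero]
    rfl

variable [FiniteDimensional ℂ V] [Finite G]

theorem coeff_finsum_single_omegaS (ω : LinearMap.BilinForm ℂ V) (c : reflections V G → ℂ) (x y : V)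
    (g : G) :
    (∑ᶠ s : reflections V G, MonoidAlgebra.single (s : G) (c s * omegaS ω (s : G) x y)).coeff g =
      Function.extend Subtype.val c 0 g * omegaS ω g x y := by
  classical
  cases nonempty_fintype G
  rw [finsum_eq_sum_of_fintype, MonoidAlgebra.coeff_sum, Finsupp.finsetSum_apply]
  simp only [MonoidAlgebra.coeff_single, Finsupp.single_apply]
  by_cases hg : g ∈ reflections V G
  · lift g to reflections V G using hg
    simp [Subtype.val_inj]
  · rw [Function.extend_apply' _ _ _ (by simpa using hg), Pi.zero_apply, zero_mul]
    exact Finset.sum_eq_zero fun s _ => if_neg (ne_of_mem_of_not_mem s.2 hg)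

open Classical in
theorem eq_single_sub_finsum_iff (ω τ : LinearMap.BilinForm ℂ V) (c : reflections V G → ℂ) :
    (∀ x y, κ x y = MonoidAlgebra.single 1 (τ x y) - (2 : ℂ) • ∑ᶠ s : reflections V G,
        MonoidAlgebra.single (s : G) (c s * omegaS ω (s : G) x y)) ↔
      ∀ g, coeffForm κ g =
        (if g = 1 then τ else 0) + (-2 * Function.extend Subtype.val c 0 g) • omegaS ω g := by
  have coeff_formula (x y : V) (g : G) :
      (MonoidAlgebra.single 1 (τ x y) - (2 : ℂ) • ∑ᶠ s : reflections V G,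
        MonoidAlgebra.single (s : G) (c s * omegaS ω (s : G) x y)).coeff g =
      ((if g = 1 then τ else 0) + (-2 * Function.extend Subtype.val c 0 g) • omegaS ω g) x y := by
    rw [MonoidAlgebra.coeff_sub, MonoidAlgebra.coeff_smul, Finsupp.sub_apply, Finsupp.smul_apply,
      coeff_finsum_single_omegaS, MonoidAlgebra.coeff_single, Finsupp.single_apply]
    split_ifs <;> simp_all [mul_assoc, sub_eq_add_neg]
  refine ⟨fun h g => LinearMap.ext₂ fun x y => ?_, fun h x y => ?_⟩
  · rw [coeffForm_apply, h, coeff_formula]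
  · ext g
    rw [coeff_formula, ← h g, coeffForm_apply]

end CoeffForm

section Classification

variable {V G : Type*} [AddCommGroup V] [Module ℂ V] [Group G] [DistribMulAction G V]
  [SMulCommClass G ℂ V] {c : reflections V G → ℂ}

theorem one_notMem_reflections : (1 : G) ∉ reflections V G := fun h => by
  rw [reflections, Set.mem_ofPred_eq, oneSub_one, LinearMap.range_zero, finrank_bot] at h
  exact two_ne_zero h.symm

theorem extend_eq_zero {g : G} (hg : g ∉ reflections V G) : Function.extend Subtype.val c 0 g = 0 :=
  Function.extend_apply' _ _ _ fun ⟨s, hs⟩ => hg (hs ▸ s.2)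

theorem extend_conj
    (hc : ∀ s s' : reflections V G, IsConj (s : G) (s' : G) → c s = c s') (g h : G) :
    Function.extend Subtype.val c 0 (h * g * h⁻¹) = Function.extend Subtype.val c 0 g := by
  by_cases hg : g ∈ reflections V G
  · have hg' := (conj_mem_reflections_iff V h).2 hg
    exact (Subtype.val_injective.extend_apply c 0 ⟨_, hg'⟩).trans
      ((hc ⟨g, hg⟩ ⟨_, hg'⟩ (isConj_iff.2 ⟨h, rfl⟩)).symm.trans
        (Subtype.val_injective.extend_apply c 0 ⟨g, hg⟩).symm)
  · rw [extend_eq_zero hg, extend_eq_zero (mt (conj_mem_reflections_iff V h).1 hg)]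

variable [FiniteDimensional ℂ V] [Finite G] {κ : V →ₗ[ℂ] V →ₗ[ℂ] MonoidAlgebra ℂ G}
  {ω : LinearMap.BilinForm ℂ V}

open Classical in
theorem isAlt_isEquivariant_satisfiesJacobi_of_coeffForm_eq {τ : LinearMap.BilinForm ℂ V}
    (hω : ω.IsAlt) (hω_inv : ∀ (g : G) (x y : V), ω (g • x) (g • y) = ω x y) (hτ : τ.IsAlt)
    (hτ_inv : ∀ (g : G) (x y : V), τ (g • x) (g • y) = τ x y)
    (hc : ∀ s s' : reflections V G, IsConj (s : G) (s' : G) → c s = c s')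
    (h : ∀ g, coeffForm κ g =
      (if g = 1 then τ else 0) + (-2 * Function.extend Subtype.val c 0 g) • omegaS ω g) :
    κ.IsAlt ∧ IsEquivariant κ ∧ SatisfiesJacobi κ := by
  rw [isAlt_iff_coeffForm, isEquivariant_iff_coeffForm, satisfiesJacobi_iff_coeffForm]
  refine ⟨fun g x => ?_, fun g k x y => ?_, fun g => ?_⟩
  · rw [h, LinearMap.add_apply, LinearMap.add_apply, LinearMap.smul_apply, LinearMap.smul_apply,
      omegaS_isAlt hω g x, smul_zero, add_zero]
    split_ifs
    · exact hτ x
    · rfl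
  · simp only [h, LinearMap.add_apply, LinearMap.smul_apply, omegaS_conj hω_inv, extend_conj hc,
      conj_eq_one_iff]
    split_ifs
    · rw [hτ_inv]
    · rfl
  · by_cases hg : g ∈ reflections V G
    · rw [h, if_neg (ne_of_mem_of_not_mem hg one_notMem_reflections), zero_add]
      exact (isJacobi_omegaS hω hg).smul _
    · rcases eq_or_ne g 1 with rfl | hg_one
      · intro x y z
        simp only [oneSub_one, LinearMap.zero_apply, smul_zero, add_zero]
      · intro x y z
        simp only [h, if_neg hg_one, extend_eq_zero hg, mul_zero, zero_smul, add_zero,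
          LinearMap.zero_apply]

theorem eq_of_isConj_of_coeffForm_eq (hω_nondeg : ω.Nondegenerate)
    (hω_inv : ∀ (g : G) (x y : V), ω (g • x) (g • y) = ω x y) (hκ : IsEquivariant κ)
    (hc : ∀ s : reflections V G, coeffForm κ (s : G) = (-2 * c s) • omegaS ω (s : G))
    {s s' : reflections V G} (h : IsConj (s : G) (s' : G)) : c s = c s' := by
  obtain ⟨g, hg⟩ := isConj_iff.1 h
  have smul_eq : (-2 * c s') • omegaS ω (s : G) = (-2 * c s) • omegaS ω (s : G) := by
    refine LinearMap.ext₂ fun x y => ?_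
    have conj := isEquivariant_iff_coeffForm.1 hκ s g x y
    rwa [hg, hc, hc, LinearMap.smul_apply, LinearMap.smul_apply, ← hg, omegaS_conj hω_inv] at conj
  exact (mul_left_cancel₀ (neg_ne_zero.2 two_ne_zero)
    (smul_left_injective ℂ (omegaS_ne_zero hω_nondeg hω_inv s.2) smul_eq)).symm

open Classical in
theorem exists_coeffForm_eq [FaithfulSMul G V] (hω : ω.IsAlt) (hω_nondeg : ω.Nondegenerate)
    (hω_inv : ∀ (g : G) (x y : V), ω (g • x) (g • y) = ω x y) (hκ_alt : κ.IsAlt)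
    (hκ : IsEquivariant κ) (hJ : SatisfiesJacobi κ) :
    ∃ c : reflections V G → ℂ,
      (∀ s s' : reflections V G, IsConj (s : G) (s' : G) → c s = c s') ∧
      ∀ g, coeffForm κ g = (if g = 1 then coeffForm κ 1 else 0) +
        (-2 * Function.extend Subtype.val c 0 g) • omegaS ω g := by
  have dichotomy (g : G) (hg : g ≠ 1) :=
    (satisfiesJacobi_iff_coeffForm.1 hJ g).eq_zero_or_eq_smul_omegaS hω hω_nondeg hω_inv hg
      (isAlt_iff_coeffForm.1 hκ_alt g)
  have exists_scalar (s : reflections V G) :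
      ∃ a : ℂ, coeffForm κ (s : G) = (-2 * a) • omegaS ω (s : G) := by
    rcases dichotomy s (ne_of_mem_of_not_mem s.2 one_notMem_reflections) with h | ⟨-, a, ha⟩
    · exact ⟨0, by rw [h, mul_zero, zero_smul]⟩
    · exact ⟨a / -2, by rw [ha, mul_div_cancel₀ a (neg_ne_zero.2 two_ne_zero)]⟩
  choose c hc using exists_scalar
  refine ⟨c, fun s s' => eq_of_isConj_of_coeffForm_eq hω_nondeg hω_inv hκ hc, fun g => ?_⟩
  rcases eq_or_ne g 1 with rfl | hg
  · rw [if_pos rfl, extend_eq_zero one_notMem_reflections, mul_zero, zero_smul, add_zero]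
  by_cases hg_mem : g ∈ reflections V G
  · lift g to reflections V G using hg_mem
    rw [hc, if_neg hg, Subtype.val_injective.extend_apply, zero_add]
  · rw [if_neg hg, extend_eq_zero hg_mem, mul_zero, zero_smul, add_zero]
    exact (dichotomy g hg).resolve_right fun h => hg_mem h.1

end Classification

end SymplecticReflection

end

theorem mainTheorem1_general {V G : Type*} [AddCommGroup V] [Module ℂ V] [FiniteDimensional ℂ V]
    [Group G] [Finite G] [DistribMulAction G V] [SMulCommClass G ℂ V] [FaithfulSMul G V]
    (ω : LinearMap.BilinForm ℂ V) (hω_alt : ω.IsAlt) (hω_nondeg : ω.Nondegenerate)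
    (hω_inv : ∀ (g : G) (x y : V), ω (g • x) (g • y) = ω x y)
    (κ : V →ₗ[ℂ] V →ₗ[ℂ] MonoidAlgebra ℂ G) :
    Function.Bijective (SymplecticReflection.xi κ) ↔
      ∃ τ : LinearMap.BilinForm ℂ V,
        (τ.IsAlt ∧ ∀ (g : G) (x y : V), τ (g • x) (g • y) = τ x y) ∧
        ∃ c : SymplecticReflection.reflections V G → ℂ,
          (∀ s s' : SymplecticReflection.reflections V G, IsConj (s : G) (s' : G) → c s = c s') ∧
          ∀ x y : V, κ x y =
            MonoidAlgebra.single 1 (τ x y) -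
              (2 : ℂ) • ∑ᶠ s : SymplecticReflection.reflections V G,
                MonoidAlgebra.single (s : G)
                  (c s * SymplecticReflection.omegaS ω (s : G) x y) := by
  open SymplecticReflection in
  simp only [bijective_xi_iff, eq_single_sub_finsum_iff]
  constructor
  · rintro ⟨hκ_alt, hκ, hJ⟩
    refine ⟨coeffForm κ 1, ⟨isAlt_iff_coeffForm.1 hκ_alt 1, fun g x y => ?_⟩,
      exists_coeffForm_eq hω_alt hω_nondeg hω_inv hκ_alt hκ hJ⟩
    simpa only [mul_one, mul_inv_cancel] using isEquivariant_iff_coeffForm.1 hκ 1 g x y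
  · rintro ⟨τ, ⟨hτ_alt, hτ_inv⟩, c, hc, h⟩
    exact isAlt_isEquivariant_satisfiesJacobi_of_coeffForm_eq hω_alt hω_inv hτ_alt hτ_inv hc h

theorem mainTheorem1 {V G : Type*} [AddCommGroup V] [Module ℂ V] [FiniteDimensional ℂ V]
    [Group G] [Finite G] [DistribMulAction G V] [SMulCommClass G ℂ V] [FaithfulSMul G V]
    (ω : LinearMap.BilinForm ℂ V) (hω_alt : ω.IsAlt) (hω_nondeg : ω.Nondegenerate)
    (hω_inv : ∀ (g : G) (x y : V), ω (g • x) (g • y) = ω x y)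
    (hG : ∀ B : LinearMap.BilinForm ℂ V, B.IsAlt →
      (∀ (g : G) (x y : V), B (g • x) (g • y) = B x y) → ∃ a : ℂ, B = a • ω)
    (κ : V →ₗ[ℂ] V →ₗ[ℂ] MonoidAlgebra ℂ G) (hκ_alt : κ.IsAlt)
    (hκ_equiv : ∀ (g : G) (x y : V),
      κ (g • x) (g • y) = MonoidAlgebra.of ℂ G g * κ x y * MonoidAlgebra.of ℂ G g⁻¹) :
    Function.Bijective (SymplecticReflection.xi κ) ↔
      ∃ (t : ℂ) (c : SymplecticReflection.reflections V G → ℂ),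
        (∀ s s' : SymplecticReflection.reflections V G, IsConj (s : G) (s' : G) → c s = c s') ∧
        ∀ x y : V, κ x y =
          MonoidAlgebra.single 1 (t * ω x y) -
            (2 : ℂ) • ∑ᶠ s : SymplecticReflection.reflections V G,
              MonoidAlgebra.single (s : G) (c s * SymplecticReflection.omegaS ω (s : G) x y) := by
  have invariant_iff (τ : LinearMap.BilinForm ℂ V) :
      (τ.IsAlt ∧ ∀ (g : G) (x y : V), τ (g • x) (g • y) = τ x y) ↔ ∃ t : ℂ, t • ω = τ :=
    ⟨fun ⟨hτ, hτ_inv⟩ => (hG τ hτ hτ_inv).imp fun _ h => h.symm, fun ⟨t, ht⟩ => ht ▸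
      ⟨fun x => by simp [hω_alt x], fun g x y => by simp [hω_inv]⟩⟩
  simp only [mainTheorem1_general ω hω_alt hω_nondeg hω_inv κ, invariant_iff, exists_exists_eq_and,
    LinearMap.smul_apply, smul_eq_mul]
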